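/- Consider the following jump game on a graph $G=(V,E)$. There is a set $N$ of $n<|V|$ agents, partitioned into $k$ non-empty types. An assignment places the agents at pairwise distinct nodes of $G$. The utility of an agent is the number of types, different from its own, that occur among the agents occupying nodes adjacent to its node. An assignment is an equilibrium if no agent can strictly increase its utility by moving to an empty node while all other agents stay in place. Let $m_1 \ge m_2 \ge 9$ and let $G$ be the $m_1\times m_2$ torus, i.e. the Cartesian product of a cycle of length $m_1$ and a cycle of length $m_2$. If $k\ge 3$, $n<m_1m_2$, and the largest type contains at least $8$ agents, then there exists an equilibrium assignment. -/

import Mathlib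

namespace VarietyJump

/-- The `m₁ × m₂` torus: the Cartesian product of the cycles of lengths `m₁` and `m₂`. -/
def torus (m₁ m₂ : ℕ) : SimpleGraph (Fin m₁ × Fin m₂) :=
  (SimpleGraph.cycleGraph m₁).boxProd (SimpleGraph.cycleGraph m₂)

/-- The number of agents of type `c`, where agent `i` has type `t i`. -/
noncomputable def typeSize {N T : Type*} (t : N → T) (c : T) : ℕ :=
  {i : N | t i = c}.ncard

/-- The set of types present at the nodes adjacent to the node `x`. -/
def typesAround {V N T : Type*} (G : SimpleGraph V) (t : N → T) (v : N → V) (x : V) : Set T :=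
  {c : T | ∃ j : N, G.Adj x (v j) ∧ t j = c}

/-- The utility of agent `i`: the number of types different from its own in its neighborhood. -/
noncomputable def utility {V N T : Type*} (G : SimpleGraph V) (t : N → T) (v : N → V)
    (i : N) : ℕ :=
  (typesAround G t v (v i) \ {t i}).ncard

/-- `v` is an equilibrium assignment: distinct agents occupy distinct nodes, and no agent can
strictly increase its utility by jumping to an empty node while all others stay in place. -/
def IsEquilibrium {V N T : Type*} [DecidableEq N] (G : SimpleGraph V) (t : N → T)
    (v : N → V) : Prop :=
  Function.Injective v ∧
    ∀ (i : N) (x : V), x ∉ Set.range v →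
      utility G t (Function.update v i x) i ≤ utility G t v i

end VarietyJump

/-!
# Equilibria of the variety jump game on a torus

Let `A` be a largest type, with `a` agents, and let `s` be the number of all other agents, so that
`s + a` is the number of agents; let `e` be the number of empty nodes. Every equilibrium built
here has a strong property: an empty node is adjacent to agents of at most one type, so a jump
never leads to a utility above `1`, and it suffices that every agent with utility `0` sees no
foreign type from any empty node (`IsEquilibrium.of_uniform_gaps`). There are two ways to fill a
set of nodes so that this holds.

* *Shielding* (`exists_equilibrium_of_shield`). The `s` agents of the other types occupy a set `Q`,
  each node of which has a neighbor outside `Q`, and agents of type `A` occupy at least the whole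
  boundary of `Q`. Then empty nodes see only type `A`, and every agent in `Q` sees an agent of type
  `A`. This needs `a` to be at least the size of the boundary of `Q`.
* *Pairing* (`exists_equilibrium_of_pairing`). The occupied nodes are divided into dominoes, each
  with one node in `L` and one in `Q`, up to a few extra nodes `X ⊆ L`, each adjacent to `Q`. List
  the agents type by type, type `A` first, and put them on `L` and then on `Q` so that the two nodes
  of a domino are `#Q` apart in the list. As no type other than `A` has more than `#Q` agents, and
  type `A` fits into `L`, the two agents of a domino have different types. If `X` and all nodes of
  `L` in a prescribed set `Y` come first in the list, and `#Y ≤ a`, they are all of type `A`; so it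
  suffices that an empty node with several occupied neighbors has all of them in `Y`.

In the layouts used for pairing at most eight nodes have to be prescribed in this way, which is
where the hypothesis `8 ≤ a` enters. The cases are the following, with `C` the number of columns.

* If `s + 4 ≤ a`, shielding works with `Q` an initial segment of the pairs of rows `3 u + 1`,
  `3 u + 2`, filled column by column: its boundary has at most `s + 4` nodes
  (`exists_equilibrium_band`). If `2 C + 5 ≤ s`, consecutive pairs of rows share at least three
  boundary nodes, so `s < a` is enough; this applies if `s < a ≤ s + 3` and `e < 2 C`.
* If `a ≤ s + 3` and `2 C ≤ e`, the agents fill consecutive rows, the last one only partly, and the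
  region is divided into vertical dominoes, with horizontal ones in row `0` where a column has odd
  height (`exists_equilibrium_rows`). If `a` exceeds `s`, one domino is broken up so that `L`
  becomes large enough; then other types have to be smaller than `s`, which holds because there
  are at least three types.
* If `a ≤ s` and `e < 2 C`, the empty nodes form two adjacent horizontal strips of nearly equal
  length, and the dominoes go around the torus vertically, with at most two rows of horizontal
  dominoes to correct parities (`exists_equilibrium_gap`). This needs an even number of rows or an
  odd number of columns, which can be achieved by exchanging rows and columns.
-/

namespace VarietyJump

/-! ### Criteria for equilibria -/

/-- If every empty node sees at most one type, then every jump leads to utility at most `1`; hence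
the assignment is an equilibrium as soon as each agent either has positive utility or sees no type
but its own from the empty nodes. -/
theorem IsEquilibrium.of_uniform_gaps {V N T : Type*} [Finite N] [DecidableEq N]
    {G : SimpleGraph V} {t : N → T} {v : N → V} (hv : Function.Injective v)
    (hgap : ∀ x ∉ Set.range v, ∀ j j', G.Adj x (v j) → G.Adj x (v j') → t j = t j')
    (hdiff : ∀ i, (∃ j, G.Adj (v i) (v j) ∧ t j ≠ t i) ∨
      ∀ x ∉ Set.range v, ∀ j, G.Adj x (v j) → t j = t i) :
    IsEquilibrium G t v := by
  refine ⟨hv, fun i x hx => ?_⟩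
  -- An agent that has jumped to `x` sees only agents that were already adjacent to `x`.
  have hsub : ∀ c ∈ typesAround G t (Function.update v i x) (Function.update v i x i),
      ∃ j, G.Adj x (v j) ∧ t j = c := by
    rintro c ⟨j, hj, rfl⟩
    rw [Function.update_self] at hj
    by_cases hji : j = i
    · subst hji
      rw [Function.update_self] at hj
      exact absurd hj (G.loopless.irrefl x)
    · rw [Function.update_of_ne hji] at hj
      exact ⟨j, hj, rfl⟩
  have hfin : ∀ w y, (typesAround G t w y \ {t i}).Finite := fun w y =>
    (Set.finite_range t).subset (by rintro _ ⟨⟨j, -, rfl⟩, -⟩; exact ⟨j, rfl⟩)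
  have hle : utility G t (Function.update v i x) i ≤ 1 := by
    refine (Set.ncard_le_one (hfin _ _)).2 ?_
    rintro c ⟨hc, -⟩ d ⟨hd, -⟩
    obtain ⟨j, hj, rfl⟩ := hsub c hc
    obtain ⟨j', hj', rfl⟩ := hsub d hd
    exact hgap x hx j j' hj hj'
  rcases hdiff i with ⟨j, hj, hji⟩ | h
  · exact hle.trans ((Set.ncard_pos (hfin _ _)).2 ⟨t j, ⟨j, hj, rfl⟩, hji⟩)
  · have : utility G t (Function.update v i x) i = 0 := by
      unfold utility
      convert Set.ncard_empty T
      rw [Set.eq_empty_iff_forall_notMem]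
      rintro c ⟨hc, hci⟩
      obtain ⟨j, hj, rfl⟩ := hsub c hc
      exact hci (h x hx j hj)
    omega

/-- Equilibria can be pulled back along an embedding of graphs that covers all occupied nodes. -/
theorem IsEquilibrium.of_comp {V V' N T : Type*} [DecidableEq N] {G : SimpleGraph V}
    {G' : SimpleGraph V'} {t : N → T} {φ : V' → V} (hφ : Function.Injective φ)
    (hadj : ∀ x y, G.Adj (φ x) (φ y) ↔ G'.Adj x y) {v : N → V'}
    (h : IsEquilibrium G t (φ ∘ v)) : IsEquilibrium G' t v := by
  have hu : ∀ (w : N → V') (i : N), utility G t (φ ∘ w) i = utility G' t w i := by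
    intro w i
    simp only [utility, typesAround, Function.comp_apply, hadj]
  refine ⟨h.1.of_comp, fun i x hx => ?_⟩
  have := h.2 i (φ x) (by
    rintro ⟨j, hj⟩
    exact hx ⟨j, hφ hj⟩)
  rw [← Function.comp_update, hu, hu] at this
  exact this

/-! ### Enumerating agents and nodes -/

/-- A finite set can be numbered `0, 1, …` in an order in which the key `k` is weakly
increasing. -/
theorem exists_monotone_enumeration {α : Type*} [DecidableEq α] (s : Finset α) (k : α → ℕ) :
    ∃ pos : α → ℕ, Set.InjOn pos s ∧ (∀ x ∈ s, pos x < s.card) ∧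
      ∀ x ∈ s, ∀ y ∈ s, k x < k y → pos x < pos y := by
  induction s using Finset.induction_on_max_value k with
  | empty => exact ⟨fun _ => 0, by simp⟩
  | insert a s ha hmax ih =>
    obtain ⟨pos, hinj, hlt, hmono⟩ := ih
    have hne : ∀ x ∈ s, x ≠ a := fun x hx h => ha (h ▸ hx)
    refine ⟨Function.update pos a s.card, ?_, ?_, ?_⟩
    · intro x hx y hy hxy
      simp only [Finset.coe_insert, Set.mem_insert_iff, Finset.mem_coe] at hx hy
      rcases hx with rfl | hx <;> rcases hy with rfl | hy
      · rfl
      · rw [Function.update_self, Function.update_of_ne (hne y hy)] at hxy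
        exact absurd hxy (hlt y hy).ne'
      · rw [Function.update_self, Function.update_of_ne (hne x hx)] at hxy
        exact absurd hxy (hlt x hx).ne
      · rw [Function.update_of_ne (hne y hy), Function.update_of_ne (hne x hx)] at hxy
        exact hinj hx hy hxy
    · intro x hx
      rw [Finset.card_insert_of_notMem ha]
      rcases Finset.mem_insert.1 hx with rfl | hx
      · simp
      · rw [Function.update_of_ne (hne x hx)]
        exact (hlt x hx).trans (Nat.lt_succ_self _)
    · intro x hx y hy hxy
      rcases Finset.mem_insert.1 hx with rfl | hx' <;> rcases Finset.mem_insert.1 hy with rfl | hy'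
      · exact absurd hxy (lt_irrefl _)
      · exact absurd hxy (not_lt.2 (hmax y hy'))
      · rw [Function.update_self, Function.update_of_ne (hne x hx')]
        exact hlt x hx'
      · rw [Function.update_of_ne (hne y hy'), Function.update_of_ne (hne x hx')]
        exact hmono x hx' y hy' hxy

/-- If all elements of `D` precede all elements of `s \ D` in a numbering of `s`, then `D` is
exactly the set of the first `#D` elements. -/
theorem mem_iff_lt_card_of_initial {α : Type*} [DecidableEq α] {s D : Finset α} {pos : α → ℕ}
    (hinj : Set.InjOn pos s) (hlt : ∀ x ∈ s, pos x < s.card) (hD : D ⊆ s)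
    (hini : ∀ x ∈ D, ∀ y ∈ s, y ∉ D → pos x < pos y) {x : α} (hx : x ∈ s) :
    x ∈ D ↔ pos x < D.card := by
  constructor
  · intro hxD
    have h1 : (s \ D).card ≤ (Finset.Ico (pos x + 1) s.card).card := by
      refine Finset.card_le_card_of_injOn pos ?_ (hinj.mono (by simp))
      intro y hy
      have hy' := Finset.mem_sdiff.1 hy
      simpa using ⟨hini x hxD y hy'.1 hy'.2, hlt y hy'.1⟩
    rw [Finset.card_sdiff_of_subset hD, Nat.card_Ico] at h1
    have := hlt x hx
    have := Finset.card_le_card hD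
    omega
  · intro h
    by_contra hxD
    have h1 : D.card ≤ (Finset.range (pos x)).card := by
      refine Finset.card_le_card_of_injOn pos ?_ (hinj.mono (by exact_mod_cast hD))
      intro y hy
      simpa using hini y hy x hx hxD
    rw [Finset.card_range] at h1
    omega

theorem exists_mem_eq_of_injOn {α : Type*} {s : Finset α} {pos : α → ℕ}
    (hinj : Set.InjOn pos s) (hlt : ∀ x ∈ s, pos x < s.card) {m : ℕ} (hm : m < s.card) :
    ∃ x ∈ s, pos x = m := by
  have h : s.image pos = Finset.range s.card := by
    refine Finset.eq_of_subset_of_card_le ?_ ?_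
    · intro y hy
      obtain ⟨x, hx, rfl⟩ := Finset.mem_image.1 hy
      exact Finset.mem_range.2 (hlt x hx)
    · rw [Finset.card_range, Finset.card_image_of_injOn hinj]
  have : m ∈ s.image pos := by rw [h]; exact Finset.mem_range.2 hm
  simpa using this

theorem typeSize_eq_card {N T : Type*} [Fintype N] (t : N → T) (c : T)
    [DecidablePred fun i => t i = c] :
    typeSize t c = (Finset.univ.filter fun i => t i = c).card := by
  unfold typeSize
  rw [← Set.ncard_coe_finset]
  simp

/-- The agents can be listed type by type with type `A` first. The last condition says that each
type is a contiguous block: two agents of the same type are less than the size of that type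
apart. -/
theorem exists_sorted_enumeration {N T : Type*} [Fintype N] [Countable T] (t : N → T) (A : T) :
    ∃ pos : N → ℕ, Function.Injective pos ∧ (∀ i, pos i < Fintype.card N) ∧
      (∀ i, t i = A ↔ pos i < typeSize t A) ∧
      ∀ i j, t i = t j → pos j < pos i + typeSize t (t i) := by
  classical
  obtain ⟨f, hf⟩ := Countable.exists_injective_nat T
  let k : T → ℕ := fun c => if c = A then 0 else f c + 1
  have hk : Function.Injective k := by
    intro c d h
    simp only [k] at h
    split_ifs at h with h1 h2 h2
    · rw [h1, h2]
    · exact hf (Nat.succ_injective h)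
  obtain ⟨pos, hinj, hlt, hmono⟩ :=
    exists_monotone_enumeration (Finset.univ : Finset N) (fun i => k (t i))
  have hinj' : Function.Injective pos := fun i j h => hinj (by simp) (by simp) h
  refine ⟨pos, hinj', fun i => hlt i (Finset.mem_univ i), fun i => ?_, fun i j hij => ?_⟩
  · rw [typeSize_eq_card, ← mem_iff_lt_card_of_initial hinj hlt (Finset.subset_univ _) ?_
      (Finset.mem_univ i)]
    · simp
    · intro x hx y _ hy
      refine hmono x (Finset.mem_univ _) y (Finset.mem_univ _) ?_
      simp only [Finset.mem_filter, Finset.mem_univ, true_and] at hx hy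
      simp [k, hx, hy]
  · by_contra hcon
    push Not at hcon
    -- The positions between `i` and `j` are all taken by agents of the same type.
    have h1 : (Finset.Icc (pos i) (pos j)).card ≤
        ((Finset.univ.filter fun l => t l = t i).image pos).card := by
      refine Finset.card_le_card fun m hm => ?_
      rw [Finset.mem_Icc] at hm
      obtain ⟨l, -, rfl⟩ := exists_mem_eq_of_injOn hinj hlt
        (hm.2.trans_lt (hlt j (Finset.mem_univ j)))
      refine Finset.mem_image_of_mem _ ?_
      simp only [Finset.mem_filter, Finset.mem_univ, true_and]
      refine hk (le_antisymm ?_ ?_)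
      · by_contra hh
        have := hmono j (Finset.mem_univ _) l (Finset.mem_univ _) (by rw [← hij]; omega)
        omega
      · by_contra hh
        have := hmono l (Finset.mem_univ _) i (Finset.mem_univ _) (by omega)
        omega
    rw [Finset.card_image_of_injective _ hinj', ← typeSize_eq_card, Nat.card_Icc] at h1
    omega

/-- Given numberings of the nodes of `S` and of equally many agents, place each agent on the node
with its number. -/
theorem exists_placement {V N : Type*} [Fintype N] {S : Finset V} (hS : S.card = Fintype.card N)
    {pos : V → ℕ} (hinj : Set.InjOn pos S) (hlt : ∀ x ∈ S, pos x < S.card)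
    {posN : N → ℕ} (hinjN : Function.Injective posN) (hltN : ∀ i, posN i < Fintype.card N) :
    ∃ v : N → V, Function.Injective v ∧ (∀ i, v i ∈ S) ∧ (∀ i, pos (v i) = posN i) ∧
      ∀ x ∈ S, ∃ i, v i = x := by
  have h : ∀ i, ∃ x ∈ S, pos x = posN i := fun i =>
    exists_mem_eq_of_injOn hinj hlt (by rw [hS]; exact hltN i)
  choose v hvS hv using h
  refine ⟨v, fun i j hij => hinjN ?_, hvS, hv, fun x hx => ?_⟩
  · rw [← hv, ← hv, hij]
  · obtain ⟨i, -, hi⟩ := exists_mem_eq_of_injOn (s := (Finset.univ : Finset N)) hinjN.injOn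
      (fun i _ => hltN i) (m := pos x) (by rw [Finset.card_univ, ← hS]; exact hlt x hx)
    exact ⟨i, hinj (hvS i) hx (by rw [hv, hi])⟩

/-! ### Shielding and pairing -/

/-- Fill `Q` with the agents of types other than `A` and the rest of `S` with type `A`. If `S`
contains the boundary of `Q`, then empty nodes see only agents of type `A`. -/
theorem exists_equilibrium_of_shield {V N T : Type*} [DecidableEq V] [Fintype N] [DecidableEq N]
    [Countable T] {G : SimpleGraph V} (t : N → T) (A : T) {S Q : Finset V} (hQS : Q ⊆ S)
    (hS : S.card = Fintype.card N) (hQ : Q.card + typeSize t A = Fintype.card N)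
    (hout : ∀ q ∈ Q, ∃ y ∈ S, y ∉ Q ∧ G.Adj q y) (hbd : ∀ q ∈ Q, ∀ x, G.Adj q x → x ∈ S) :
    ∃ v : N → V, IsEquilibrium G t v ∧ ∀ i, v i ∈ S := by
  obtain ⟨posN, hinjN, hltN, hA, -⟩ := exists_sorted_enumeration t A
  obtain ⟨pos, hinj, hlt, hmono⟩ := exists_monotone_enumeration S (fun x => if x ∈ Q then 1 else 0)
  obtain ⟨v, hv, hvS, hpos, hsurj⟩ := exists_placement hS hinj hlt hinjN hltN
  have hcard : (S \ Q).card = typeSize t A := by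
    rw [Finset.card_sdiff_of_subset hQS]; omega
  have htype : ∀ i, t i = A ↔ v i ∉ Q := by
    intro i
    rw [hA, ← hpos, ← hcard, ← mem_iff_lt_card_of_initial hinj hlt Finset.sdiff_subset ?_ (hvS i)]
    · simp [hvS i]
    · intro x hx y hy hy'
      refine hmono x (Finset.mem_sdiff.1 hx).1 y hy ?_
      simp only [Finset.mem_sdiff, not_and, not_not] at hx hy'
      simp [hx.2, hy' hy]
  have hgapA : ∀ x ∉ Set.range v, ∀ j, G.Adj x (v j) → t j = A := by
    intro x hx j hj
    rw [htype]
    intro hjQ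
    obtain ⟨i, rfl⟩ := hsurj x (hbd _ hjQ x hj.symm)
    exact hx ⟨i, rfl⟩
  refine ⟨v, IsEquilibrium.of_uniform_gaps hv ?_ ?_, hvS⟩
  · intro x hx j j' hj hj'
    rw [hgapA x hx j hj, hgapA x hx j' hj']
  · intro i
    by_cases hi : t i = A
    · exact Or.inr fun x hx j hj => by rw [hgapA x hx j hj, hi]
    · left
      have hiQ : v i ∈ Q := by
        by_contra h
        exact hi ((htype i).2 h)
      obtain ⟨y, hyS, hyQ, hy⟩ := hout _ hiQ
      obtain ⟨j, rfl⟩ := hsurj y hyS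
      refine ⟨j, hy, ?_⟩
      rw [(htype j).2 hyQ]
      exact Ne.symm hi

/-- The nodes of `L ∪ Q` outside `X` are partitioned into edges of `G`, each with one end in `L`
and one in `Q`; the involution `π` exchanges the ends of each edge. The extra nodes `X ⊆ L` are
unpaired but adjacent to `Q`. -/
structure IsPairing {V : Type*} (G : SimpleGraph V) (L Q X : Finset V) (π : V → V) : Prop where
  disjoint : Disjoint L Q
  subset : X ⊆ L
  mem_left : ∀ q ∈ Q, π q ∈ L
  notMem_extra : ∀ q ∈ Q, π q ∉ X
  mem_right : ∀ p ∈ L, p ∉ X → π p ∈ Q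
  invol_right : ∀ q ∈ Q, π (π q) = q
  invol_left : ∀ p ∈ L, p ∉ X → π (π p) = p
  adj : ∀ q ∈ Q, G.Adj q (π q)
  adj_extra : ∀ p ∈ X, ∃ q ∈ Q, G.Adj p q

theorem IsPairing.card_left {V : Type*} [DecidableEq V] {G : SimpleGraph V} {L Q X : Finset V}
    {π : V → V} (h : IsPairing G L Q X π) : L.card = X.card + Q.card := by
  have h1 : Q.card = (L \ X).card := by
    refine Finset.card_bij' (fun q _ => π q) (fun p _ => π p) ?_ ?_ ?_ ?_
    · exact fun q hq => Finset.mem_sdiff.2 ⟨h.mem_left q hq, h.notMem_extra q hq⟩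
    · exact fun p hp => h.mem_right p (Finset.mem_sdiff.1 hp).1 (Finset.mem_sdiff.1 hp).2
    · exact fun q hq => h.invol_right q hq
    · exact fun p hp => h.invol_left p (Finset.mem_sdiff.1 hp).1 (Finset.mem_sdiff.1 hp).2
  rw [Finset.card_sdiff_of_subset h.subset] at h1
  have := Finset.card_le_card h.subset
  omega

/-- Break the edge between `q₀` and its partner: both become extra nodes in `L`. This needs other
nodes `q₁` and `q₂` of `Q` adjacent to them, and the old extra nodes must not depend on `q₀`. -/
theorem IsPairing.erase {V : Type*} [DecidableEq V] {G : SimpleGraph V} {L Q X : Finset V}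
    {π : V → V} (h : IsPairing G L Q X π) {q₀ q₁ q₂ : V} (h₀ : q₀ ∈ Q) (h₁ : q₁ ∈ Q)
    (h₂ : q₂ ∈ Q) (h₁₀ : G.Adj q₀ q₁) (h₂₀ : q₂ ≠ q₀) (hp : G.Adj (π q₀) q₂)
    (hX : ∀ p ∈ X, ∃ q ∈ Q, q ≠ q₀ ∧ G.Adj p q) :
    IsPairing G (insert q₀ L) (Q.erase q₀) (insert q₀ (insert (π q₀) X)) π := by
  have hLQ : ∀ x ∈ L, x ∉ Q := fun x hx hx' => Finset.disjoint_left.1 h.disjoint hx hx'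
  refine ⟨?_, ?_, ?_, ?_, ?_, ?_, ?_, ?_, ?_⟩
  · rw [Finset.disjoint_left]
    intro x hx hx'
    rw [Finset.mem_erase] at hx'
    rcases Finset.mem_insert.1 hx with rfl | hx
    · exact hx'.1 rfl
    · exact hLQ x hx hx'.2
  · intro x hx
    simp only [Finset.mem_insert] at hx ⊢
    rcases hx with rfl | rfl | hx
    · exact Or.inl rfl
    · exact Or.inr (h.mem_left _ h₀)
    · exact Or.inr (h.subset hx)
  · exact fun q hq => Finset.mem_insert_of_mem (h.mem_left q (Finset.mem_erase.1 hq).2)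
  · intro q hq
    rw [Finset.mem_erase] at hq
    simp only [Finset.mem_insert, not_or]
    refine ⟨fun e => hLQ _ (h.mem_left q hq.2) (e ▸ h₀), fun e => hq.1 ?_, h.notMem_extra q hq.2⟩
    rw [← h.invol_right q hq.2, e, h.invol_right q₀ h₀]
  · intro p hp hpX
    simp only [Finset.mem_insert, not_or] at hp hpX
    have hpL : p ∈ L := hp.resolve_left hpX.1
    refine Finset.mem_erase.2 ⟨fun e => hpX.2.1 ?_, h.mem_right p hpL hpX.2.2⟩
    rw [← e, h.invol_left p hpL hpX.2.2]
  · exact fun q hq => h.invol_right q (Finset.mem_erase.1 hq).2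
  · intro p hp hpX
    simp only [Finset.mem_insert, not_or] at hp hpX
    exact h.invol_left p (hp.resolve_left hpX.1) hpX.2.2
  · exact fun q hq => h.adj q (Finset.mem_erase.1 hq).2
  · intro p hpX
    simp only [Finset.mem_insert] at hpX
    rcases hpX with rfl | rfl | hpX
    · exact ⟨q₁, Finset.mem_erase.2 ⟨h₁₀.ne', h₁⟩, h₁₀⟩
    · exact ⟨q₂, Finset.mem_erase.2 ⟨h₂₀, h₂⟩, hp⟩
    · obtain ⟨q, hq, hne, hadj⟩ := hX p hpX
      exact ⟨q, Finset.mem_erase.2 ⟨hne, hq⟩, hadj⟩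

/-- Place the agents, sorted by type with `A` first, on `L` and then on `Q`, such that partners
are `#Q` places apart. Types other than `A` have at most `#Q` agents and type `A` fits into `L`,
so partners have different types. The nodes of `Y` come first and are all of type `A`, so empty
nodes may see several of them. -/
theorem exists_equilibrium_of_pairing {V N T : Type*} [DecidableEq V] [Fintype N] [DecidableEq N]
    [Countable T] {G : SimpleGraph V} (t : N → T) (A : T) {L Q X Y : Finset V} {π : V → V}
    (h : IsPairing G L Q X π) (hcard : L.card + Q.card = Fintype.card N)
    (hXY : X ⊆ Y) (hYL : Y ⊆ L) (hYA : Y.card ≤ typeSize t A) (hA : typeSize t A ≤ L.card)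
    (hB : ∀ c ≠ A, typeSize t c ≤ Q.card)
    (hgap : ∀ x ∉ L ∪ Q, ∀ y ∈ L ∪ Q, ∀ y' ∈ L ∪ Q, G.Adj x y → G.Adj x y' →
      y = y' ∨ y ∈ Y ∧ y' ∈ Y) :
    ∃ v : N → V, IsEquilibrium G t v ∧ ∀ i, v i ∈ L ∪ Q := by
  have hLQ : ∀ x ∈ Q, x ∉ L := fun x hx hx' => Finset.disjoint_left.1 h.disjoint hx' hx
  have hS : (L ∪ Q).card = Fintype.card N := by
    rw [Finset.card_union_of_disjoint h.disjoint, hcard]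
  obtain ⟨posN, hinjN, hltN, hposA, hposT⟩ := exists_sorted_enumeration t A
  obtain ⟨posL, hinjL, hltL, hmonoL⟩ := exists_monotone_enumeration L
    (fun x => if x ∈ X then 0 else if x ∈ Y then 1 else 2)
  have hposX : ∀ x ∈ L, (x ∈ X ↔ posL x < X.card) := fun x hx =>
    mem_iff_lt_card_of_initial hinjL hltL h.subset (fun y hy z hz hz' => hmonoL y (h.subset hy) z hz
      (by simp only [hy, hz', if_true, if_false]; split_ifs <;> omega)) hx
  have hposY : ∀ x ∈ L, (x ∈ Y ↔ posL x < Y.card) := fun x hx =>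
    mem_iff_lt_card_of_initial hinjL hltL hYL (fun y hy z hz hz' => hmonoL y (hYL hy) z hz (by
      have : z ∉ X := fun e => hz' (hXY e)
      simp only [hy, hz', this, if_true, if_false]; split_ifs <;> omega)) hx
  let pos : V → ℕ := fun x => if x ∈ L then posL x else posL (π x) + Q.card
  have hpL : ∀ x ∈ L, pos x = posL x := fun x hx => if_pos hx
  have hpQ : ∀ x ∈ Q, pos x = posL (π x) + Q.card := fun x hx => if_neg (hLQ x hx)
  have hLcard := h.card_left
  have hQge : ∀ x ∈ Q, L.card ≤ pos x := by
    intro x hx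
    have := (hposX _ (h.mem_left x hx)).not.1 (h.notMem_extra x hx)
    rw [hpQ x hx]
    omega
  have hlt : ∀ x ∈ L ∪ Q, pos x < (L ∪ Q).card := by
    intro x hx
    rw [hS, ← hcard]
    rcases Finset.mem_union.1 hx with hx | hx
    · rw [hpL x hx]
      have := hltL x hx
      omega
    · rw [hpQ x hx]
      have := hltL _ (h.mem_left x hx)
      omega
  have hinj : Set.InjOn pos ((L ∪ Q : Finset V) : Set V) := by
    intro x hx y hy hxy
    rcases Finset.mem_union.1 hx with hx | hx <;> rcases Finset.mem_union.1 hy with hy | hy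
    · rw [hpL x hx, hpL y hy] at hxy
      exact hinjL hx hy hxy
    · have h1 := hQge y hy
      have h2 := hltL x hx
      rw [hpL x hx] at hxy
      omega
    · have h1 := hQge x hx
      have h2 := hltL y hy
      rw [hpL y hy] at hxy
      omega
    · rw [hpQ x hx, hpQ y hy] at hxy
      have := hinjL (h.mem_left x hx) (h.mem_left y hy) (by omega)
      rw [← h.invol_right x hx, this, h.invol_right y hy]
  obtain ⟨v, hv, hvS, hpos, hsurj⟩ := exists_placement hS hinj hlt hinjN hltN
  have hQA : ∀ j, v j ∈ Q → t j ≠ A := by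
    intro j hj hjA
    have h1 := (hposA j).1 hjA
    have h2 := hQge _ hj
    rw [hpos] at h2
    omega
  have hYA' : ∀ j, v j ∈ Y → t j = A := by
    intro j hj
    have h1 := (hposY _ (hYL hj)).1 hj
    rw [hposA, ← hpos, hpL _ (hYL hj)]
    omega
  have hpair : ∀ i j, v j ∈ Q → v i = π (v j) → t i ≠ t j := by
    intro i j hj hi hij
    have h1 := hposT i j hij
    have h2 := hB (t i) (by rw [hij]; exact hQA j hj)
    rw [← hpos, ← hpos, hpQ _ hj, hi, hpL _ (h.mem_left _ hj)] at h1
    omega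
  refine ⟨v, IsEquilibrium.of_uniform_gaps hv ?_ fun i => Or.inl ?_, hvS⟩
  · intro x hx j j' hj hj'
    have hxS : x ∉ L ∪ Q := fun hxS => hx (hsurj x hxS)
    rcases hgap x hxS _ (hvS j) _ (hvS j') hj hj' with e | ⟨e, e'⟩
    · rw [hv e]
    · rw [hYA' j e, hYA' j' e']
  · by_cases hiQ : v i ∈ Q
    · obtain ⟨j, hj⟩ := hsurj _ (Finset.mem_union_left Q (h.mem_left _ hiQ))
      exact ⟨j, hj ▸ h.adj _ hiQ, hpair j i hiQ hj⟩
    have hiL : v i ∈ L := (Finset.mem_union.1 (hvS i)).resolve_right hiQ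
    by_cases hiX : v i ∈ X
    · obtain ⟨q, hq, hadj⟩ := h.adj_extra _ hiX
      obtain ⟨j, rfl⟩ := hsurj q (Finset.mem_union_right L hq)
      refine ⟨j, hadj, ?_⟩
      rw [hYA' i (hXY hiX)]
      exact hQA j hq
    · have hq := h.mem_right _ hiL hiX
      obtain ⟨j, hj⟩ := hsurj _ (Finset.mem_union_right L hq)
      have hi := h.invol_left _ hiL hiX
      have hadj := h.adj _ hq
      rw [hi] at hadj
      refine ⟨j, hj ▸ hadj.symm, (hpair i j (hj ▸ hq) ?_).symm⟩
      rw [hj, hi]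

/-! ### The torus on natural number coordinates -/

/-- The `R × C` torus with nodes `(i, j)`, `i < R`, `j < C`, inside `ℕ × ℕ`; all other pairs are
isolated. The first coordinate is the row. Plain natural numbers make adjacency a matter of linear
arithmetic. A wraparound edge between `0` and `R - 1` is written without subtraction, and the
conditions `0 < y.1` and the like exclude loops when there is only one row or column. -/
def natTorus (R C : ℕ) : SimpleGraph (ℕ × ℕ) where
  Adj x y := (x.1 < R ∧ x.2 < C ∧ y.1 < R ∧ y.2 < C) ∧
    ((x.2 = y.2 ∧ (x.1 + 1 = y.1 ∨ y.1 + 1 = x.1 ∨ (x.1 = 0 ∧ 0 < y.1 ∧ y.1 + 1 = R) ∨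
        (y.1 = 0 ∧ 0 < x.1 ∧ x.1 + 1 = R))) ∨
      (x.1 = y.1 ∧ (x.2 + 1 = y.2 ∨ y.2 + 1 = x.2 ∨ (x.2 = 0 ∧ 0 < y.2 ∧ y.2 + 1 = C) ∨
        (y.2 = 0 ∧ 0 < x.2 ∧ x.2 + 1 = C))))
  symm := ⟨by rintro ⟨a, b⟩ ⟨c, d⟩; dsimp only; omega⟩
  loopless := ⟨by rintro ⟨a, b⟩; dsimp only; omega⟩

theorem natTorus_adj {R C i j i' j' : ℕ} : (natTorus R C).Adj (i, j) (i', j') ↔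
    (i < R ∧ j < C ∧ i' < R ∧ j' < C) ∧
    ((j = j' ∧ (i + 1 = i' ∨ i' + 1 = i ∨ (i = 0 ∧ 0 < i' ∧ i' + 1 = R) ∨
        (i' = 0 ∧ 0 < i ∧ i + 1 = R))) ∨
      (i = i' ∧ (j + 1 = j' ∨ j' + 1 = j ∨ (j = 0 ∧ 0 < j' ∧ j' + 1 = C) ∨
        (j' = 0 ∧ 0 < j ∧ j + 1 = C)))) := Iff.rfl

theorem cycleGraph_adj_val {n : ℕ} (u v : Fin n) : (SimpleGraph.cycleGraph n).Adj u v ↔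
    u ≠ v ∧ (u.val + 1 = v.val ∨ v.val + 1 = u.val ∨ (u.val = 0 ∧ 0 < v.val ∧ v.val + 1 = n) ∨
      (v.val = 0 ∧ 0 < u.val ∧ u.val + 1 = n)) := by
  have h : ∀ a b : Fin n, (a - b).val = 1 → b.val + 1 = a.val ∨ (a.val + n = b.val + 1) := by
    intro a b hab
    rcases le_or_gt b a with hba | hba
    · rw [Fin.sub_val_of_le hba] at hab
      omega
    · rw [Fin.coe_sub_iff_lt.2 hba] at hab
      omega
  have h' : ∀ a b : Fin n, b.val + 1 = a.val ∨ (a.val + n = b.val + 1 ∧ a ≠ b) →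
      (a - b).val = 1 := by
    intro a b hab
    rcases le_or_gt b a with hba | hba
    · rw [Fin.sub_val_of_le hba]
      have := Fin.le_def.1 hba
      rcases hab with hab | ⟨hab, hne⟩
      · omega
      · have := Fin.val_ne_of_ne hne
        omega
    · rw [Fin.coe_sub_iff_lt.2 hba]
      have := Fin.lt_def.1 hba
      omega
  rw [SimpleGraph.cycleGraph_adj']
  have hu := u.isLt
  have hv := v.isLt
  constructor
  · intro huv
    have hne : u ≠ v := by
      rintro rfl
      have : NeZero n := ⟨by omega⟩
      simp at huv
    have := Fin.val_ne_of_ne hne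
    refine ⟨hne, ?_⟩
    rcases huv with huv | huv
    · have := h _ _ huv
      omega
    · have := h _ _ huv
      omega
  · rintro ⟨hne, huv⟩
    have hne' := Fin.val_ne_of_ne hne
    rcases huv with huv | huv | huv | huv
    · exact Or.inr (h' _ _ (Or.inl huv))
    · exact Or.inl (h' _ _ (Or.inl huv))
    · exact Or.inl (h' _ _ (Or.inr ⟨by omega, hne⟩))
    · exact Or.inr (h' _ _ (Or.inr ⟨by omega, hne.symm⟩))

theorem torus_adj_iff {R C : ℕ} (x y : Fin R × Fin C) :
    (torus R C).Adj x y ↔ (natTorus R C).Adj (x.1.val, x.2.val) (y.1.val, y.2.val) := by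
  obtain ⟨a, b⟩ := x
  obtain ⟨c, d⟩ := y
  rw [torus, SimpleGraph.boxProd_adj, natTorus_adj, cycleGraph_adj_val, cycleGraph_adj_val]
  simp only [ne_eq, Fin.ext_iff]
  have := a.isLt
  have := b.isLt
  have := c.isLt
  have := d.isLt
  omega

theorem exists_equilibrium_torus {N T : Type*} [DecidableEq N] {R C : ℕ} {t : N → T}
    (h : ∃ v : N → ℕ × ℕ, IsEquilibrium (natTorus R C) t v ∧ ∀ i, (v i).1 < R ∧ (v i).2 < C) :
    ∃ v : N → Fin R × Fin C, IsEquilibrium (torus R C) t v := by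
  obtain ⟨v, hv, hb⟩ := h
  refine ⟨fun i => (⟨(v i).1, (hb i).1⟩, ⟨(v i).2, (hb i).2⟩),
    IsEquilibrium.of_comp (φ := fun x => (x.1.val, x.2.val)) ?_
      (fun x y => (torus_adj_iff x y).symm) hv⟩
  rintro ⟨a, b⟩ ⟨c, d⟩ h
  simpa [Fin.ext_iff] using h

/-- Rows and columns may be exchanged. -/
theorem exists_equilibrium_torus_swap {N T : Type*} [DecidableEq N] {R C : ℕ} {t : N → T}
    (h : ∃ v : N → ℕ × ℕ, IsEquilibrium (natTorus R C) t v ∧ ∀ i, (v i).1 < R ∧ (v i).2 < C) :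
    ∃ v : N → Fin C × Fin R, IsEquilibrium (torus C R) t v := by
  obtain ⟨v, hv, hb⟩ := h
  refine ⟨fun i => (⟨(v i).2, (hb i).2⟩, ⟨(v i).1, (hb i).1⟩),
    IsEquilibrium.of_comp (φ := fun x => (x.2.val, x.1.val)) ?_ (fun x y => ?_) hv⟩
  · rintro ⟨a, b⟩ ⟨c, d⟩ h
    simpa [Fin.ext_iff, and_comm] using h
  · rw [torus_adj_iff, natTorus_adj, natTorus_adj]
    exact and_congr
      ⟨fun h => ⟨h.2.1, h.1, h.2.2.2, h.2.2.1⟩, fun h => ⟨h.2.1, h.1, h.2.2.2, h.2.2.1⟩⟩ or_comm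

/-! ### Regions of the torus -/

open Classical in
/-- The nodes of the `R × C` torus satisfying `P`. -/
noncomputable def box (R C : ℕ) (P : ℕ → ℕ → Prop) : Finset (ℕ × ℕ) :=
  (Finset.range R ×ˢ Finset.range C).filter fun x => P x.1 x.2

theorem mem_box {R C : ℕ} {P : ℕ → ℕ → Prop} {i j : ℕ} :
    (i, j) ∈ box R C P ↔ (i < R ∧ j < C) ∧ P i j := by
  classical
  simp [box]

theorem box_lt {R C : ℕ} {P : ℕ → ℕ → Prop} {x : ℕ × ℕ} (h : x ∈ box R C P) :
    x.1 < R ∧ x.2 < C := (mem_box.1 h).1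

theorem card_box_true (R C : ℕ) : (box R C fun _ _ => True).card = R * C := by
  classical
  simp [box]

theorem card_box_le_length {R C : ℕ} {P : ℕ → ℕ → Prop} (l : List (ℕ × ℕ))
    (h : ∀ i j, i < R → j < C → P i j → (i, j) ∈ l) : (box R C P).card ≤ l.length := by
  classical
  refine (Finset.card_le_card (t := l.toFinset) ?_).trans l.toFinset_card_le
  rintro ⟨i, j⟩ hx
  rw [mem_box] at hx
  exact List.mem_toFinset.2 (h i j hx.1.1 hx.1.2 hx.2)

/-! ### Dominoes in columns of given heights -/

/-- Consider columns `j` occupied in rows `i < H j`, divided into vertical dominoes from the last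
row up. A column of odd height leaves a node in row `0`; if the odd columns are those from `o` on,
these remaining nodes are paired horizontally, starting at column `o`. The predicate selects the
upper node of each vertical and the right node of each horizontal domino. -/
def columnsRight (H : ℕ → ℕ) (o i j : ℕ) : Prop :=
  i % 2 = H j % 2 ∨ (i = 0 ∧ H j % 2 = 1 ∧ (j - o) % 2 = 1)

/-- The other node of the domino of `x` in the division described at `columnsRight`. -/
def columnsPartner (H : ℕ → ℕ) (o : ℕ) (x : ℕ × ℕ) : ℕ × ℕ :=
  if x.1 % 2 = H x.2 % 2 then (x.1 + 1, x.2)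
  else if x.1 ≠ 0 then (x.1 - 1, x.2)
  else if (x.2 - o) % 2 = 1 then (0, x.2 - 1) else (0, x.2 + 1)

theorem columnsPartner_of_eq {H : ℕ → ℕ} {o i j : ℕ} (h : i % 2 = H j % 2) :
    columnsPartner H o (i, j) = (i + 1, j) := if_pos h

theorem columnsPartner_succ {H : ℕ → ℕ} {o i j : ℕ} (h : i % 2 = H j % 2) :
    columnsPartner H o (i + 1, j) = (i, j) := by
  unfold columnsPartner
  dsimp only
  rw [if_neg (by omega), if_pos (by omega)]
  rfl

theorem columnsPartner_top_right {H : ℕ → ℕ} {o j : ℕ} (h : H j % 2 = 1) (hj : (j - o) % 2 = 1) :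
    columnsPartner H o (0, j) = (0, j - 1) := by
  unfold columnsPartner
  dsimp only
  rw [if_neg (by omega), if_neg (by omega), if_pos hj]

theorem columnsPartner_top_left {H : ℕ → ℕ} {o j : ℕ} (h : H j % 2 = 1) (hj : (j - o) % 2 = 0) :
    columnsPartner H o (0, j) = (0, j + 1) := by
  unfold columnsPartner
  dsimp only
  rw [if_neg (by omega), if_neg (by omega), if_neg (by omega)]

/-- A selected node is the upper node of a vertical domino or the right node of a horizontal
one. -/
theorem columnsRight_cases {W o o' i j : ℕ} {H : ℕ → ℕ}
    (hodd : ∀ j < W, o ≤ j ∧ j < o' ↔ H j % 2 = 1)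
    (hj : j < W) (hi : i < H j) (h : columnsRight H o i j) :
    (i % 2 = H j % 2 ∧ i + 1 < H j) ∨
      ∃ k, i = 0 ∧ j = k + 1 ∧ (k - o) % 2 = 0 ∧ (k + 1 - o) % 2 = 1 ∧ o ≤ k ∧ k + 1 < o' ∧
        H k % 2 = 1 ∧ H (k + 1) % 2 = 1 := by
  rcases h with h | ⟨rfl, h1, h2⟩
  · left; omega
  · right
    have h3 := (hodd j hj).2 h1
    obtain ⟨k, rfl⟩ : ∃ k, j = k + 1 := ⟨j - 1, by omega⟩
    exact ⟨k, rfl, rfl, by omega, by omega, by omega, by omega,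
      (hodd k (by omega)).1 (by omega), h1⟩

/-- A node that is neither selected nor extra is the lower node of a vertical domino or the left
node of a horizontal one. -/
theorem columnsLeft_cases {W o o' i j : ℕ} {H : ℕ → ℕ}
    (hodd : ∀ j < W, o ≤ j ∧ j < o' ↔ H j % 2 = 1)
    (ho' : o' ≤ W) (hj : j < W) (h : ¬ columnsRight H o i j)
    (hX : ¬ (i = 0 ∧ o ≤ j ∧ j + 1 = o' ∧ (o' - o) % 2 = 1)) :
    (∃ l, i = l + 1 ∧ l % 2 = H j % 2) ∨
      i = 0 ∧ (j - o) % 2 = 0 ∧ (j + 1 - o) % 2 = 1 ∧ o ≤ j ∧ j + 1 < o' ∧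
        H j % 2 = 1 ∧ H (j + 1) % 2 = 1 := by
  unfold columnsRight at h
  push Not at h
  rcases Nat.eq_zero_or_pos i with rfl | hi
  · right
    have h1 : H j % 2 = 1 := by omega
    have h2 := h.2 rfl h1
    have h3 := (hodd j hj).2 h1
    have h4 : j + 1 < o' := by omega
    exact ⟨rfl, by omega, by omega, h3.1, h4, h1, (hodd (j + 1) (by omega)).1 ⟨by omega, h4⟩⟩
  · left
    exact ⟨i - 1, by omega, by omega⟩

/-- If the columns of odd height are exactly those in `[o, o')`, the dominoes of `columnsRight`
cover everything except, when `o' - o` is odd, the top of the last odd column. That node is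
adjacent to the upper node of a vertical domino. -/
theorem isPairing_columns {R C W o o' : ℕ} {H : ℕ → ℕ} (hW : W ≤ C)
    (hodd : ∀ j < W, o ≤ j ∧ j < o' ↔ H j % 2 = 1) (ho' : o' ≤ W) (hH : ∀ j < W, 2 ≤ H j)
    (hR : ∀ j < W, H j < R) :
    IsPairing (natTorus R C)
      (box R C fun i j => (j < W ∧ i < H j) ∧ ¬ columnsRight H o i j)
      (box R C fun i j => (j < W ∧ i < H j) ∧ columnsRight H o i j)
      (box R C fun i j => i = 0 ∧ o ≤ j ∧ j + 1 = o' ∧ (o' - o) % 2 = 1)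
      (columnsPartner H o) where
  disjoint := by
    rw [Finset.disjoint_left]
    rintro ⟨i, j⟩ h h'
    rw [mem_box] at h h'
    exact h.2.2 h'.2.2
  subset := by
    rintro ⟨i, j⟩ h
    rw [mem_box] at h ⊢
    obtain ⟨h, rfl, h1, h2, h3⟩ := h
    have hj : j < W := by omega
    have h4 := (hodd j hj).1 ⟨h1, by omega⟩
    have h5 := hH j hj
    refine ⟨h, ⟨hj, by omega⟩, ?_⟩
    rintro (h | h) <;> omega
  mem_left := by
    rintro ⟨i, j⟩ h
    rw [mem_box] at h
    obtain ⟨-, ⟨hj, hi⟩, h⟩ := h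
    have h4 := hR j hj
    rcases columnsRight_cases hodd hj hi h with ⟨h1, h2⟩ | ⟨k, rfl, rfl, h1, h2, h3, h5, h6, h7⟩
    · rw [columnsPartner_of_eq h1, mem_box]
      refine ⟨by omega, ⟨hj, h2⟩, ?_⟩
      rintro (h | h) <;> omega
    · rw [columnsPartner_top_right h7 h2, mem_box, Nat.add_sub_cancel]
      have := hH k (by omega)
      refine ⟨by omega, by omega, ?_⟩
      rintro (h | h) <;> omega
  notMem_extra := by
    rintro ⟨i, j⟩ h
    rw [mem_box] at h
    obtain ⟨-, ⟨hj, hi⟩, h⟩ := h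
    rcases columnsRight_cases hodd hj hi h with ⟨h1, h2⟩ | ⟨k, rfl, rfl, h1, h2, h3, h5, h6, h7⟩
    · rw [columnsPartner_of_eq h1, mem_box]
      omega
    · rw [columnsPartner_top_right h7 h2, mem_box, Nat.add_sub_cancel]
      omega
  mem_right := by
    rintro ⟨i, j⟩ h hX
    rw [mem_box] at h hX
    obtain ⟨hb, ⟨hj, hi⟩, h⟩ := h
    rcases columnsLeft_cases hodd ho' hj h (fun e => hX ⟨hb, e⟩) with
      ⟨l, rfl, h1⟩ | ⟨rfl, h1, h2, h3, h5, h6, h7⟩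
    · rw [columnsPartner_succ h1, mem_box]
      exact ⟨by omega, by omega, Or.inl h1⟩
    · rw [columnsPartner_top_left h6 h1, mem_box]
      have := hH (j + 1) (by omega)
      exact ⟨by omega, by omega, Or.inr ⟨rfl, h7, h2⟩⟩
  invol_right := by
    rintro ⟨i, j⟩ h
    rw [mem_box] at h
    obtain ⟨-, ⟨hj, hi⟩, h⟩ := h
    rcases columnsRight_cases hodd hj hi h with ⟨h1, h2⟩ | ⟨k, rfl, rfl, h1, h2, h3, h5, h6, h7⟩
    · rw [columnsPartner_of_eq h1, columnsPartner_succ h1]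
    · rw [columnsPartner_top_right h7 h2, Nat.add_sub_cancel, columnsPartner_top_left h6 h1]
  invol_left := by
    rintro ⟨i, j⟩ h hX
    rw [mem_box] at h hX
    obtain ⟨hb, ⟨hj, hi⟩, h⟩ := h
    rcases columnsLeft_cases hodd ho' hj h (fun e => hX ⟨hb, e⟩) with
      ⟨l, rfl, h1⟩ | ⟨rfl, h1, h2, h3, h5, h6, h7⟩
    · rw [columnsPartner_succ h1, columnsPartner_of_eq h1]
    · rw [columnsPartner_top_left h6 h1, columnsPartner_top_right h7 h2, Nat.add_sub_cancel]
  adj := by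
    rintro ⟨i, j⟩ h
    rw [mem_box] at h
    obtain ⟨hb, ⟨hj, hi⟩, h⟩ := h
    have h4 := hR j hj
    rcases columnsRight_cases hodd hj hi h with ⟨h1, h2⟩ | ⟨k, rfl, rfl, h1, h2, h3, h5, h6, h7⟩
    · rw [columnsPartner_of_eq h1, natTorus_adj]
      exact ⟨by omega, Or.inl ⟨rfl, Or.inl rfl⟩⟩
    · rw [columnsPartner_top_right h7 h2, natTorus_adj, Nat.add_sub_cancel]
      exact ⟨by omega, Or.inr ⟨rfl, Or.inr (Or.inl rfl)⟩⟩
  adj_extra := by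
    rintro ⟨i, j⟩ h
    rw [mem_box] at h
    obtain ⟨hb, rfl, h1, h2, h3⟩ := h
    have hj : j < W := by omega
    have h4 := (hodd j hj).1 ⟨h1, by omega⟩
    have h5 := hH j hj
    have h6 := hR j hj
    refine ⟨(1, j), ?_, ?_⟩
    · rw [mem_box]
      exact ⟨by omega, by omega, Or.inl h4.symm⟩
    · rw [natTorus_adj]
      exact ⟨by omega, Or.inl ⟨rfl, Or.inl rfl⟩⟩

/-! ### Dominoes in columns around the torus -/

/-- Data for a division into dominoes of a region whose columns wrap around the torus. Column `j`
consists of the rows from `α j` to `ω j - 1`, where `ω j` is `R` or `R + 1`, and row `R` stands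
for row `0`. It begins with a vertical domino in rows `α j` and `α j + 1`, continues with nodes of
horizontal dominoes up to row `β j - 1`, and ends with vertical dominoes from row `β j` on. If
`β j = α j + 1`, there is only the unpaired node in row `α j` before row `β j`. Horizontal
dominoes have their left node where row plus column is even; the fields `right` and `left` say
that they are complete. -/
structure ColumnProfile (R C : ℕ) (α β ω : ℕ → ℕ) : Prop where
  one_le : ∀ j < C, 1 ≤ α j
  lt : ∀ j < C, α j < β j
  lt_rows : ∀ j < C, β j < R
  end_eq : ∀ j < C, ω j = R ∨ ω j = R + 1
  parity : ∀ j < C, ω j % 2 = β j % 2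
  right : ∀ i j, j < C → α j + 2 ≤ i → i < β j → (i + j) % 2 = 1 →
    ∃ k, j = k + 1 ∧ α k + 2 ≤ i ∧ i < β k
  left : ∀ i j, j < C → α j + 2 ≤ i → i < β j → (i + j) % 2 = 0 →
    j + 1 < C ∧ α (j + 1) + 2 ≤ i ∧ i < β (j + 1)

/-- The region with columns from row `α j` to row `ω j - 1`, as in `ColumnProfile`. -/
def profileRegion (R : ℕ) (α ω : ℕ → ℕ) (i j : ℕ) : Prop :=
  α j ≤ i ∨ (i = 0 ∧ ω j = R + 1)

/-- One node of each domino of a `ColumnProfile`: the lower node of the first vertical domino of a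
column, the right node of each horizontal domino, and the upper node of each vertical domino from
row `β j` on. -/
def profileRight (α β : ℕ → ℕ) (i j : ℕ) : Prop :=
  (β j ≤ i ∧ i % 2 = β j % 2) ∨ (i = α j + 1 ∧ i < β j) ∨
    (α j + 2 ≤ i ∧ i < β j ∧ (i + j) % 2 = 1)

/-- The other node of the domino of `x` in a `ColumnProfile`. -/
def profilePartner (R : ℕ) (α β : ℕ → ℕ) (x : ℕ × ℕ) : ℕ × ℕ :=
  if β x.2 ≤ x.1 ∧ x.1 % 2 = β x.2 % 2 then
    if x.1 + 1 = R then (0, x.2) else (x.1 + 1, x.2)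
  else if x.1 = 0 then (R - 1, x.2)
  else if β x.2 ≤ x.1 then (x.1 - 1, x.2)
  else if x.1 = α x.2 then (x.1 + 1, x.2)
  else if x.1 = α x.2 + 1 then (x.1 - 1, x.2)
  else if (x.1 + x.2) % 2 = 1 then (x.1, x.2 - 1)
  else (x.1, x.2 + 1)

section partner
variable {R i j : ℕ} {α β : ℕ → ℕ}

theorem profilePartner_down (h : β j ≤ i) (hi : i % 2 = β j % 2) (hR : i + 1 < R) :
    profilePartner R α β (i, j) = (i + 1, j) := by
  unfold profilePartner
  dsimp only
  rw [if_pos ⟨h, hi⟩, if_neg (by omega)]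

theorem profilePartner_down_succ (h : β j ≤ i) (hi : i % 2 = β j % 2) :
    profilePartner R α β (i + 1, j) = (i, j) := by
  unfold profilePartner
  dsimp only
  rw [if_neg (by omega), if_neg (by omega), if_pos (by omega), Nat.add_sub_cancel]

theorem profilePartner_last (h : β j ≤ i) (hi : i % 2 = β j % 2) (hR : i + 1 = R) :
    profilePartner R α β (i, j) = (0, j) := by
  unfold profilePartner
  dsimp only
  rw [if_pos ⟨h, hi⟩, if_pos hR]

theorem profilePartner_zero (h : 0 < β j) (hR : i + 1 = R) :
    profilePartner R α β (0, j) = (i, j) := by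
  unfold profilePartner
  dsimp only
  rw [if_neg (by omega), if_pos rfl, ← hR, Nat.add_sub_cancel]

theorem profilePartner_top (h : α j + 1 < β j) (hi : 1 ≤ α j) :
    profilePartner R α β (α j, j) = (α j + 1, j) := by
  unfold profilePartner
  dsimp only
  rw [if_neg (by omega), if_neg (by omega), if_neg (by omega), if_pos rfl]

theorem profilePartner_top_succ (h : α j + 1 < β j) :
    profilePartner R α β (α j + 1, j) = (α j, j) := by
  unfold profilePartner
  dsimp only
  rw [if_neg (by omega), if_neg (by omega), if_neg (by omega), if_neg (by omega), if_pos rfl,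
    Nat.add_sub_cancel]

theorem profilePartner_right (h : α j + 2 ≤ i) (h' : i < β j) (hi : (i + j) % 2 = 1) :
    profilePartner R α β (i, j) = (i, j - 1) := by
  unfold profilePartner
  dsimp only
  rw [if_neg (by omega), if_neg (by omega), if_neg (by omega), if_neg (by omega),
    if_neg (by omega), if_pos hi]

theorem profilePartner_left (h : α j + 2 ≤ i) (h' : i < β j) (hi : (i + j) % 2 = 0) :
    profilePartner R α β (i, j) = (i, j + 1) := by
  unfold profilePartner
  dsimp only
  rw [if_neg (by omega), if_neg (by omega), if_neg (by omega), if_neg (by omega),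
    if_neg (by omega), if_neg (by omega)]

end partner

/-- A selected node is the upper node of a late vertical domino (whose lower node is possibly in
row `0`), the lower node of the first vertical domino, or the right node of a horizontal one. -/
theorem ColumnProfile.right_cases {R C i j : ℕ} {α β ω : ℕ → ℕ} (h : ColumnProfile R C α β ω)
    (hi : i < R) (hj : j < C) (hr : profileRight α β i j) :
    (β j ≤ i ∧ i % 2 = β j % 2 ∧ i + 1 < R) ∨
    (β j ≤ i ∧ i % 2 = β j % 2 ∧ i + 1 = R ∧ ω j = R + 1) ∨
    (i = α j + 1 ∧ α j + 1 < β j) ∨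
    ∃ k, j = k + 1 ∧ α (k + 1) + 2 ≤ i ∧ i < β (k + 1) ∧ (i + (k + 1)) % 2 = 1 ∧
      α k + 2 ≤ i ∧ i < β k ∧ (i + k) % 2 = 0 := by
  rcases hr with ⟨h1, h2⟩ | ⟨h1, h2⟩ | ⟨h1, h2, h3⟩
  · have h3 := h.end_eq j hj
    have h4 := h.parity j hj
    omega
  · omega
  · obtain ⟨k, rfl, h4, h5⟩ := h.right i j hj h1 h2 h3
    exact Or.inr (Or.inr (Or.inr ⟨k, rfl, h1, h2, h3, h4, h5, by omega⟩))

/-- The complementary list for a node that is neither selected nor extra. -/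
theorem ColumnProfile.left_cases {R C i j : ℕ} {α β ω : ℕ → ℕ} (h : ColumnProfile R C α β ω)
    (hj : j < C) (hS : profileRegion R α ω i j) (hr : ¬ profileRight α β i j)
    (hX : ¬ (i = α j ∧ β j = α j + 1)) :
    (∃ l, i = l + 1 ∧ β j ≤ l ∧ l % 2 = β j % 2) ∨
    (∃ l, l + 1 = R ∧ i = 0 ∧ β j ≤ l ∧ l % 2 = β j % 2) ∨
    (i = α j ∧ α j + 1 < β j) ∨
    (α j + 2 ≤ i ∧ i < β j ∧ (i + j) % 2 = 0 ∧
      j + 1 < C ∧ α (j + 1) + 2 ≤ i ∧ i < β (j + 1) ∧ (i + (j + 1)) % 2 = 1) := by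
  have h1 := h.one_le j hj
  have h2 := h.lt j hj
  have h3 := h.lt_rows j hj
  have h4 := h.parity j hj
  unfold profileRight at hr
  push Not at hr
  obtain ⟨hr1, hr2, hr3⟩ := hr
  rcases hS with hS | ⟨rfl, hS⟩
  · rcases le_or_gt (β j) i with h5 | h5
    · left
      have := hr1 h5
      exact ⟨i - 1, by omega, by omega, by omega⟩
    · right; right
      rcases Nat.lt_or_ge i (α j + 2) with h6 | h6
      · omega
      · right
        have h7 : (i + j) % 2 = 0 := by
          have := hr3 h6 h5
          omega
        obtain ⟨h8, h9, h10⟩ := h.left i j hj h6 h5 h7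
        exact ⟨h6, h5, h7, h8, h9, h10, by omega⟩
  · right; left
    exact ⟨R - 1, by omega, rfl, by omega, by omega⟩

theorem ColumnProfile.isPairing {R C : ℕ} {α β ω : ℕ → ℕ} (h : ColumnProfile R C α β ω) :
    IsPairing (natTorus R C)
      (box R C fun i j => profileRegion R α ω i j ∧ ¬ profileRight α β i j)
      (box R C fun i j => profileRegion R α ω i j ∧ profileRight α β i j)
      (box R C fun i j => i = α j ∧ β j = α j + 1)
      (profilePartner R α β) where
  disjoint := by
    rw [Finset.disjoint_left]
    rintro ⟨i, j⟩ h1 h2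
    rw [mem_box] at h1 h2
    exact h1.2.2 h2.2.2
  subset := by
    rintro ⟨i, j⟩ hx
    rw [mem_box] at hx ⊢
    obtain ⟨hb, rfl, h1⟩ := hx
    refine ⟨hb, Or.inl le_rfl, ?_⟩
    rintro (h2 | h2 | h2) <;> omega
  mem_left := by
    rintro ⟨i, j⟩ hx
    rw [mem_box] at hx
    obtain ⟨⟨hi, hj⟩, hS, hr⟩ := hx
    have h1 := h.one_le j hj
    have h2 := h.lt j hj
    rcases h.right_cases hi hj hr with ⟨h3, h4, h5⟩ | ⟨h3, h4, h5, h6⟩ | ⟨rfl, h3⟩ |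
      ⟨k, rfl, h3, h4, h5, h6, h7, h8⟩
    · rw [profilePartner_down h3 h4 h5, mem_box]
      refine ⟨⟨h5, hj⟩, Or.inl (by omega), ?_⟩
      rintro (h6 | h6 | h6) <;> omega
    · rw [profilePartner_last h3 h4 h5, mem_box]
      refine ⟨⟨by omega, hj⟩, Or.inr ⟨rfl, h6⟩, ?_⟩
      rintro (h6 | h6 | h6) <;> omega
    · rw [profilePartner_top_succ h3, mem_box]
      refine ⟨⟨by omega, hj⟩, Or.inl le_rfl, ?_⟩
      rintro (h6 | h6 | h6) <;> omega
    · rw [profilePartner_right h3 h4 h5, mem_box, Nat.add_sub_cancel]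
      refine ⟨⟨by omega, by omega⟩, Or.inl (by omega), ?_⟩
      rintro (h6 | h6 | h6) <;> omega
  notMem_extra := by
    rintro ⟨i, j⟩ hx
    rw [mem_box] at hx
    obtain ⟨⟨hi, hj⟩, hS, hr⟩ := hx
    have h1 := h.one_le j hj
    have h2 := h.lt j hj
    rcases h.right_cases hi hj hr with ⟨h3, h4, h5⟩ | ⟨h3, h4, h5, h6⟩ | ⟨rfl, h3⟩ |
      ⟨k, rfl, h3, h4, h5, h6, h7, h8⟩
    · rw [profilePartner_down h3 h4 h5, mem_box]
      omega
    · rw [profilePartner_last h3 h4 h5, mem_box]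
      omega
    · rw [profilePartner_top_succ h3, mem_box]
      omega
    · rw [profilePartner_right h3 h4 h5, mem_box, Nat.add_sub_cancel]
      omega
  mem_right := by
    rintro ⟨i, j⟩ hx hX
    rw [mem_box] at hx hX
    obtain ⟨⟨hi, hj⟩, hS, hr⟩ := hx
    have h2 := h.lt j hj
    rcases h.left_cases hj hS hr (fun e => hX ⟨⟨hi, hj⟩, e⟩) with ⟨l, rfl, h3, h4⟩ |
      ⟨l, h3, rfl, h4, h5⟩ | ⟨rfl, h3⟩ | ⟨h3, h4, h5, h6, h7, h8, h9⟩
    · rw [profilePartner_down_succ h3 h4, mem_box]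
      exact ⟨⟨by omega, hj⟩, Or.inl (by omega), Or.inl ⟨h3, h4⟩⟩
    · rw [profilePartner_zero (by omega) h3, mem_box]
      exact ⟨⟨by omega, hj⟩, Or.inl (by omega), Or.inl ⟨h4, h5⟩⟩
    · have h4 := h.lt_rows j hj
      rw [profilePartner_top h3 (h.one_le j hj), mem_box]
      exact ⟨⟨by omega, hj⟩, Or.inl (by omega), Or.inr (Or.inl ⟨rfl, h3⟩)⟩
    · rw [profilePartner_left h3 h4 h5, mem_box]
      exact ⟨⟨hi, h6⟩, Or.inl (by omega), Or.inr (Or.inr ⟨h7, h8, h9⟩)⟩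
  invol_right := by
    rintro ⟨i, j⟩ hx
    rw [mem_box] at hx
    obtain ⟨⟨hi, hj⟩, hS, hr⟩ := hx
    have h2 := h.lt j hj
    rcases h.right_cases hi hj hr with ⟨h3, h4, h5⟩ | ⟨h3, h4, h5, h6⟩ | ⟨rfl, h3⟩ |
      ⟨k, rfl, h3, h4, h5, h6, h7, h8⟩
    · rw [profilePartner_down h3 h4 h5, profilePartner_down_succ h3 h4]
    · rw [profilePartner_last h3 h4 h5, profilePartner_zero (by omega) h5]
    · rw [profilePartner_top_succ h3, profilePartner_top h3 (h.one_le j hj)]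
    · rw [profilePartner_right h3 h4 h5, Nat.add_sub_cancel, profilePartner_left h6 h7 h8]
  invol_left := by
    rintro ⟨i, j⟩ hx hX
    rw [mem_box] at hx hX
    obtain ⟨⟨hi, hj⟩, hS, hr⟩ := hx
    have h2 := h.lt j hj
    rcases h.left_cases hj hS hr (fun e => hX ⟨⟨hi, hj⟩, e⟩) with ⟨l, rfl, h3, h4⟩ |
      ⟨l, h3, rfl, h4, h5⟩ | ⟨rfl, h3⟩ | ⟨h3, h4, h5, h6, h7, h8, h9⟩
    · rw [profilePartner_down_succ h3 h4, profilePartner_down h3 h4 hi]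
    · rw [profilePartner_zero (by omega) h3, profilePartner_last h4 h5 h3]
    · rw [profilePartner_top h3 (h.one_le j hj), profilePartner_top_succ h3]
    · rw [profilePartner_left h3 h4 h5, profilePartner_right h7 h8 h9, Nat.add_sub_cancel]
  adj := by
    rintro ⟨i, j⟩ hx
    rw [mem_box] at hx
    obtain ⟨⟨hi, hj⟩, hS, hr⟩ := hx
    have h2 := h.lt j hj
    rcases h.right_cases hi hj hr with ⟨h3, h4, h5⟩ | ⟨h3, h4, h5, h6⟩ | ⟨rfl, h3⟩ |
      ⟨k, rfl, h3, h4, h5, h6, h7, h8⟩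
    · rw [profilePartner_down h3 h4 h5, natTorus_adj]
      exact ⟨by omega, Or.inl ⟨rfl, Or.inl rfl⟩⟩
    · rw [profilePartner_last h3 h4 h5, natTorus_adj]
      exact ⟨by omega, Or.inl ⟨rfl, Or.inr (Or.inr (Or.inr ⟨rfl, by omega, h5⟩))⟩⟩
    · rw [profilePartner_top_succ h3, natTorus_adj]
      exact ⟨by omega, Or.inl ⟨rfl, Or.inr (Or.inl rfl)⟩⟩
    · rw [profilePartner_right h3 h4 h5, natTorus_adj, Nat.add_sub_cancel]
      exact ⟨by omega, Or.inr ⟨rfl, Or.inr (Or.inl rfl)⟩⟩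
  adj_extra := by
    rintro ⟨i, j⟩ hx
    rw [mem_box] at hx
    obtain ⟨⟨hi, hj⟩, rfl, h1⟩ := hx
    have h2 := h.lt_rows j hj
    refine ⟨(α j + 1, j), ?_, ?_⟩
    · rw [mem_box]
      exact ⟨by omega, Or.inl (by omega), Or.inl (by omega)⟩
    · rw [natTorus_adj]
      exact ⟨by omega, Or.inl ⟨rfl, Or.inl rfl⟩⟩

theorem box_union_not (R C : ℕ) (P Q : ℕ → ℕ → Prop) :
    (box R C fun i j => P i j ∧ ¬ Q i j) ∪ (box R C fun i j => P i j ∧ Q i j) = box R C P := by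
  ext ⟨i, j⟩
  simp only [Finset.mem_union, mem_box]
  tauto

theorem card_box_not_add (R C : ℕ) (P Q : ℕ → ℕ → Prop) :
    (box R C fun i j => P i j ∧ ¬ Q i j).card + (box R C fun i j => P i j ∧ Q i j).card =
      (box R C P).card := by
  rw [← box_union_not R C P Q, Finset.card_union_of_disjoint]
  rw [Finset.disjoint_left]
  rintro ⟨i, j⟩ h h'
  rw [mem_box] at h h'
  exact h.2.2 h'.2.2

/-! ### Few empty nodes -/

/-- The first occupied row in column `j` when the empty nodes are those in row `0` and columns
`j < b + δ` together with those in row `1` and columns `j < b`. Row `0` itself, where occupied, is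
counted as row `R`. -/
def gapTop (b j : ℕ) : ℕ := if j < b then 2 else 1

/-- One more than the last occupied row in column `j`, for the empty nodes described at
`gapTop`. -/
def gapEnd (R b δ j : ℕ) : ℕ := if j < b + δ then R else R + 1

/-- The row from which column `j` has vertical dominoes down to its end. If `R` is even, the
columns split into vertical dominoes, except that column `b` has one node too many if `δ = 1`. If
`R` is odd, every column, except column `b` if `δ = 1`, has one node too many for this: it is put
in row `4` in the columns `j < b` and in row `3` in the columns `j > b`, where horizontal dominoes
take care of it. Column `b` and column `b - 1` are adjusted to the parity of `b`, leaving at most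
one unpaired node. -/
def gapStart (R b δ j : ℕ) : ℕ :=
  if R % 2 = 0 then if j < b then 4 else if j < b + δ then 2 else 3
  else if j < b then if δ = 0 ∧ b % 2 = 1 ∧ j + 1 = b then 3 else 5
  else if j < b + δ then if b % 2 = 0 then 3 else 5
  else if δ = 0 ∧ b % 2 = 0 ∧ j = b then 2 else 4

/-- For odd `R`, the horizontal dominoes in row `3` have their left nodes in odd columns and end
in column `C - 1`, so `C` must be odd. -/
theorem columnProfile_gap {R C b δ : ℕ} (hR : 9 ≤ R) (hpar : R % 2 = 0 ∨ C % 2 = 1)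
    (hb : b + 1 ≤ C) (hδ : δ ≤ 1) :
    ColumnProfile R C (gapTop b) (gapStart R b δ) (gapEnd R b δ) where
  one_le j _ := by unfold gapTop; split_ifs <;> omega
  lt j _ := by unfold gapTop gapStart; split_ifs <;> omega
  lt_rows j _ := by unfold gapStart; split_ifs <;> omega
  end_eq j _ := by unfold gapEnd; split_ifs <;> omega
  parity j _ := by unfold gapEnd gapStart; split_ifs <;> omega
  right i j hj h1 h2 h3 := by
    refine ⟨j - 1, ?_⟩
    unfold gapTop gapStart at *
    split_ifs at * <;> omega
  left i j hj h1 h2 h3 := by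
    unfold gapTop gapStart at *
    split_ifs at * <;> omega

theorem profileRegion_gap_iff {R b δ i j : ℕ} :
    profileRegion R (gapTop b) (gapEnd R b δ) i j ↔
      ¬ (i = 0 ∧ j < b + δ ∨ i = 1 ∧ j < b) := by
  unfold profileRegion gapTop gapEnd
  split_ifs <;> omega

theorem card_gap_region {R C b δ : ℕ} (hR : 9 ≤ R) (hb : b + δ ≤ C) :
    (box R C (profileRegion R (gapTop b) (gapEnd R b δ))).card + (2 * b + δ) = R * C := by
  have h1 : box R C (profileRegion R (gapTop b) (gapEnd R b δ)) =
      box R C (fun _ _ => True) \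
        (({0} ×ˢ Finset.range (b + δ)) ∪ ({1} ×ˢ Finset.range b)) := by
    ext ⟨i, j⟩
    simp only [Finset.mem_sdiff, mem_box, Finset.mem_union, Finset.mem_product,
      Finset.mem_singleton, Finset.mem_range, and_true]
    constructor
    · rintro ⟨⟨hi, hj⟩, h⟩
      exact ⟨⟨hi, hj⟩, profileRegion_gap_iff.1 h⟩
    · rintro ⟨⟨hi, hj⟩, h⟩
      exact ⟨⟨hi, hj⟩, profileRegion_gap_iff.2 h⟩
  have h2 : (({0} ×ˢ Finset.range (b + δ)) ∪ ({1} ×ˢ Finset.range b) : Finset (ℕ × ℕ)).card =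
      2 * b + δ := by
    rw [Finset.card_union_of_disjoint]
    · simp only [Finset.card_product, Finset.card_singleton, Finset.card_range]
      omega
    · rw [Finset.disjoint_left]
      rintro ⟨i, j⟩ h h'
      simp only [Finset.mem_product, Finset.mem_singleton] at h h'
      omega
  have h3 : (({0} ×ˢ Finset.range (b + δ)) ∪ ({1} ×ˢ Finset.range b) : Finset (ℕ × ℕ)) ⊆
      box R C (fun _ _ => True) := by
    rintro ⟨i, j⟩ h
    simp only [Finset.mem_union, Finset.mem_product, Finset.mem_singleton, Finset.mem_range] at h
    rw [mem_box]
    exact ⟨by omega, trivial⟩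
  have h4 := Finset.card_le_card h3
  rw [h1, Finset.card_sdiff_of_subset h3, h2, card_box_true]
  rw [h2, card_box_true] at h4
  omega

/-- The nodes, at most eight, that are allowed to share an empty neighbor with another occupied
node: the occupied neighbors of the empty nodes at the four ends of the two empty rows. -/
def gapCorner (R C b δ i j : ℕ) : Prop :=
  (δ = 0 ∧ ((i = 2 ∨ i + 1 = R) ∧ (j = 0 ∨ j + 1 = b) ∨ (i = 0 ∨ i = 1) ∧ (j = b ∨ j + 1 = C))) ∨
  (δ = 1 ∧ (i + 1 = R ∧ (j = 0 ∨ j = b) ∨ i = 2 ∧ 1 ≤ b ∧ (j = 0 ∨ j + 1 = b) ∨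
    i = 1 ∧ (j = b ∨ j + 1 = C) ∨ i = 0 ∧ (j = b + 1 ∨ j + 1 = C)))

theorem mem_of_gapCorner_zero {R C b i j : ℕ} (h : gapCorner R C b 0 i j) :
    (i, j) ∈ [(2, 0), (2, b - 1), (R - 1, 0), (R - 1, b - 1),
      (0, b), (0, C - 1), (1, b), (1, C - 1)] := by
  simp only [List.mem_cons, Prod.mk.injEq, List.not_mem_nil, or_false]
  rcases h with ⟨-, ⟨h1 | h1, h2 | h2⟩ | ⟨h1 | h1, h2 | h2⟩⟩ | ⟨h, -⟩
  · left; omega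
  · iterate 1 right
    left; omega
  · iterate 2 right
    left; omega
  · iterate 3 right
    left; omega
  · iterate 4 right
    left; omega
  · iterate 5 right
    left; omega
  · iterate 6 right
    left; omega
  · iterate 7 right
    omega
  · omega

theorem mem_of_gapCorner_one {R C b i j : ℕ} (h : gapCorner R C b 1 i j) :
    (i, j) ∈ [(R - 1, 0), (R - 1, b), (2, 0), (2, b - 1),
      (1, b), (1, C - 1), (0, b + 1), (0, C - 1)] := by
  simp only [List.mem_cons, Prod.mk.injEq, List.not_mem_nil, or_false]
  rcases h with ⟨h, -⟩ | ⟨-, ⟨h1, h2 | h2⟩ | ⟨h1, -, h2 | h2⟩ | ⟨h1, h2 | h2⟩ | ⟨h1, h2 | h2⟩⟩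
  · omega
  · left; omega
  · iterate 1 right
    left; omega
  · iterate 2 right
    left; omega
  · iterate 3 right
    left; omega
  · iterate 4 right
    left; omega
  · iterate 5 right
    left; omega
  · iterate 6 right
    left; omega
  · iterate 7 right
    omega

theorem not_profileRight_of_gapCorner {R C b δ i j : ℕ} (hR : 9 ≤ R)
    (hb : 1 ≤ b + δ) (hδ : δ ≤ 1) (hbC : b + 1 ≤ C) (hc : gapCorner R C b δ i j) :
    ¬ profileRight (gapTop b) (gapStart R b δ) i j := by
  unfold profileRight gapTop gapStart
  unfold gapCorner at hc
  split_ifs <;> omega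

theorem gapCorner_of_extra {R C b δ i j : ℕ}
    (hδ : δ ≤ 1) (h : i = gapTop b j ∧ gapStart R b δ j = gapTop b j + 1) :
    gapCorner R C b δ i j := by
  unfold gapTop gapStart at h
  unfold gapCorner
  split_ifs at h <;> omega

/-- An occupied neighbor of an empty node is one of the corners, or the empty node is in the
interior of one of the empty rows and the neighbor is the one vertically opposite to the other
empty row. -/
theorem gap_adj_cases {R C b δ i j i' j' : ℕ} (hR : 9 ≤ R) (hC : 9 ≤ C) (hδ : δ ≤ 1)
    (hbC : b + 1 ≤ C) (hS : i = 0 ∧ j < b + δ ∨ i = 1 ∧ j < b)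
    (hS' : ¬ (i' = 0 ∧ j' < b + δ ∨ i' = 1 ∧ j' < b))
    (hadj : (natTorus R C).Adj (i, j) (i', j')) :
    gapCorner R C b δ i' j' ∨
      (j' = j ∧ 1 ≤ j ∧ (i = 0 ∧ i' + 1 = R ∧ j < b ∧ (j + 1 < b ∨ δ = 1) ∨
        i = 1 ∧ i' = 2 ∧ j + 1 < b)) := by
  rw [natTorus_adj] at hadj
  unfold gapCorner
  obtain ⟨hb, hadj⟩ := hadj
  rcases Nat.le_one_iff_eq_zero_or_eq_one.1 hδ with rfl | rfl <;>
  rcases hS with ⟨rfl, hS⟩ | ⟨rfl, hS⟩ <;>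
  rcases hadj with ⟨rfl, h | h | h | h⟩ | ⟨rfl, h | h | h | h⟩ <;>
  simp only [zero_ne_one, one_ne_zero, false_and, true_and, false_or, or_false, or_true, and_true,
    add_zero] at * <;>
  omega

/-- An empty node in the interior of one of the empty rows has only one occupied neighbor. -/
theorem not_adj_gap {R C b δ i j i' j' : ℕ} (hR : 9 ≤ R) (hδ : δ ≤ 1)
    (hbC : b + 1 ≤ C) (hS : 1 ≤ j ∧ (i = 0 ∧ j < b ∧ (j + 1 < b ∨ δ = 1) ∨ i = 1 ∧ j + 1 < b))
    (hS' : ¬ (i' = 0 ∧ j' < b + δ ∨ i' = 1 ∧ j' < b))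
    (hadj : (natTorus R C).Adj (i, j) (i', j')) :
    j' = j ∧ (i = 0 ∧ i' + 1 = R ∨ i = 1 ∧ i' = 2) := by
  rw [natTorus_adj] at hadj
  rcases hadj with ⟨hb, ⟨rfl, h | h | h | h⟩ | ⟨rfl, h | h | h | h⟩⟩ <;> omega

/-- Equilibria when fewer than `2 C` nodes are empty and `A` has at most half of the agents: the
`2 b + δ` empty nodes are the ones described at `gapTop`. -/
theorem exists_equilibrium_gap {N T : Type*} [Fintype N] [DecidableEq N] [Countable T]
    {R C : ℕ} (hR : 9 ≤ R) (hC : 9 ≤ C) (hpar : R % 2 = 0 ∨ C % 2 = 1) {b δ : ℕ}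
    (hb : 1 ≤ b + δ) (hδ : δ ≤ 1) (hbC : b + 1 ≤ C)
    (hN : Fintype.card N + (2 * b + δ) = R * C) (t : N → T) (A : T)
    (hmax : ∀ c, typeSize t c ≤ typeSize t A) (h8 : 8 ≤ typeSize t A)
    (hhalf : 2 * typeSize t A ≤ Fintype.card N) :
    ∃ v : N → ℕ × ℕ, IsEquilibrium (natTorus R C) t v ∧ ∀ i, (v i).1 < R ∧ (v i).2 < C := by
  have hp := (columnProfile_gap hR hpar hbC hδ).isPairing
  have hcard := card_gap_region (C := C) hR (show b + δ ≤ C by omega)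
  have hLQ := card_box_not_add R C (profileRegion R (gapTop b) (gapEnd R b δ))
    (profileRight (gapTop b) (gapStart R b δ))
  have hL := hp.card_left
  have hX : (box R C fun i j => i = gapTop b j ∧ gapStart R b δ j = gapTop b j + 1).card ≤ 1 := by
    refine card_box_le_length
      [if δ = 1 then (1, b) else if b % 2 = 1 then (2, b - 1) else (1, b)] ?_
    intro i j _ _ h
    rw [List.mem_singleton]
    unfold gapTop gapStart at h
    split_ifs at h ⊢ <;> simp only [Prod.mk.injEq] <;> omega
  have hY : (box R C fun i j => gapCorner R C b δ i j ∧
      profileRegion R (gapTop b) (gapEnd R b δ) i j).card ≤ 8 := by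
    rcases Nat.le_one_iff_eq_zero_or_eq_one.1 hδ with rfl | rfl
    · refine card_box_le_length [(2, 0), (2, b - 1), (R - 1, 0), (R - 1, b - 1),
        (0, b), (0, C - 1), (1, b), (1, C - 1)] ?_
      exact fun i j _ _ h => mem_of_gapCorner_zero h.1
    · refine card_box_le_length [(R - 1, 0), (R - 1, b), (2, 0), (2, b - 1),
        (1, b), (1, C - 1), (0, b + 1), (0, C - 1)] ?_
      exact fun i j _ _ h => mem_of_gapCorner_one h.1
  refine (exists_equilibrium_of_pairing t A hp (by omega)
    (Y := box R C fun i j => gapCorner R C b δ i j ∧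
      profileRegion R (gapTop b) (gapEnd R b δ) i j) ?_ ?_ (by omega) (by omega) ?_ ?_).imp
    fun v hv => ⟨hv.1, fun i => box_lt (box_union_not R C _ _ ▸ hv.2 i)⟩
  · rintro ⟨i, j⟩ h
    have h1 := hp.subset h
    rw [mem_box] at h h1 ⊢
    exact ⟨h.1, gapCorner_of_extra hδ h.2, h1.2.1⟩
  · rintro ⟨i, j⟩ h
    rw [mem_box] at h ⊢
    exact ⟨h.1, h.2.2, not_profileRight_of_gapCorner hR hb hδ hbC h.2.1⟩
  · intro c _
    have := hmax c
    omega
  · rw [box_union_not]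
    rintro ⟨i, j⟩ hx ⟨i₁, j₁⟩ h₁ ⟨i₂, j₂⟩ h₂ hadj₁ hadj₂
    have hij := (natTorus_adj.1 hadj₁).1
    rw [mem_box] at hx h₁ h₂
    have hx' : i = 0 ∧ j < b + δ ∨ i = 1 ∧ j < b := by
      by_contra hcon
      exact hx ⟨⟨hij.1, hij.2.1⟩, profileRegion_gap_iff.2 hcon⟩
    have h₁' := profileRegion_gap_iff.1 h₁.2
    have h₂' := profileRegion_gap_iff.1 h₂.2
    rcases gap_adj_cases hR hC hδ hbC hx' h₁' hadj₁ with h | h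
    · rcases gap_adj_cases hR hC hδ hbC hx' h₂' hadj₂ with h' | h'
      · right
        rw [mem_box, mem_box]
        exact ⟨⟨h₁.1, h, h₁.2⟩, h₂.1, h', h₂.2⟩
      · left
        have := not_adj_gap hR hδ hbC (by omega) h₁' hadj₁
        rw [Prod.mk.injEq]
        omega
    · left
      have := not_adj_gap hR hδ hbC (by omega) h₂' hadj₂
      rw [Prod.mk.injEq]
      omega

/-! ### Agents in consecutive rows -/

/-- The number of occupied rows in column `j` when rows `0, …, r - 1` are occupied and row `r` is
occupied in the columns `j < c`. -/
def rowHeight (r c j : ℕ) : ℕ := if j < c then r + 1 else r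

theorem lt_rowHeight_iff {r c i j : ℕ} : i < rowHeight r c j ↔ i < r ∨ (i = r ∧ j < c) := by
  unfold rowHeight
  split_ifs <;> omega

theorem card_rows_region {R C W r c : ℕ} (hW : W ≤ C) (hc : c < W)
    (hR : ∀ j < W, rowHeight r c j < R) :
    (box R C fun i j => j < W ∧ i < rowHeight r c j).card = r * W + c := by
  have h1 : (box R C fun i j => j < W ∧ i < rowHeight r c j) =
      (Finset.range r ×ˢ Finset.range W) ∪ ({r} ×ˢ Finset.range c) := by
    ext ⟨i, j⟩
    simp only [mem_box, Finset.mem_union, Finset.mem_product, Finset.mem_singleton,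
      Finset.mem_range]
    have h2 := hR j
    have h3 : i < rowHeight r c j ↔ i < r ∨ (i = r ∧ j < c) := lt_rowHeight_iff
    omega
  rw [h1, Finset.card_union_of_disjoint]
  · simp
  · rw [Finset.disjoint_left]
    rintro ⟨i, j⟩ h h'
    simp only [Finset.mem_product, Finset.mem_singleton, Finset.mem_range] at h h'
    omega

/-- The nodes, at most four, adjacent to the ends of the unoccupied part of row `r`. -/
def notchCorner (W r c i j : ℕ) : Prop :=
  1 ≤ c ∧ (i = r ∧ (j = 0 ∨ j + 1 = c) ∨ i + 1 = r ∧ (j = c ∨ j + 1 = W))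

theorem mem_of_notchCorner {W r c i j : ℕ} (h : notchCorner W r c i j) :
    (i, j) ∈ [(r, 0), (r, c - 1), (r - 1, c), (r - 1, W - 1)] := by
  simp only [List.mem_cons, Prod.mk.injEq, List.not_mem_nil, or_false]
  obtain ⟨h, ⟨h1, h2 | h2⟩ | ⟨h1, h2 | h2⟩⟩ := h <;> omega

/-- Occupied neighbors of an empty node at an end of the unoccupied part of row `r` are notch
corners. -/
theorem notchCorner_of_adj {R C W r c i j i' j' : ℕ} (hc : c < W) (hr : 1 ≤ r)
    (hR : r + 3 ≤ R) (hx : i = r ∧ 1 ≤ c ∧ j < W ∧ (j = c ∨ j + 1 = C))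
    (hW : W ≤ C) (hS : ¬ (i < r ∨ (i = r ∧ j < c))) (hS' : j' < W ∧ (i' < r ∨ (i' = r ∧ j' < c)))
    (hadj : (natTorus R C).Adj (i, j) (i', j')) : notchCorner W r c i' j' := by
  rw [natTorus_adj] at hadj
  unfold notchCorner
  rcases hadj with ⟨hb, ⟨rfl, h | h | h | h⟩ | ⟨rfl, h | h | h | h⟩⟩ <;> omega

/-- Any other empty node has at most one occupied neighbor: from column `W` on it lies in the row
of the empty node, otherwise in its column. Two free columns and two free rows prevent the
wraparound from creating a second one. -/
theorem rows_adj_cases {R C W r c i j i' j' : ℕ} (hc : c < W) (hr : 1 ≤ r)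
    (hR : r + 3 ≤ R ∨ (c = 0 ∧ r + 2 ≤ R)) (hW : W = C ∨ W + 2 ≤ C)
    (hx : ¬ (i = r ∧ 1 ≤ c ∧ j < W ∧ (j = c ∨ j + 1 = C)))
    (hS : ¬ (j < W ∧ (i < r ∨ (i = r ∧ j < c)))) (hS' : j' < W ∧ (i' < r ∨ (i' = r ∧ j' < c)))
    (hadj : (natTorus R C).Adj (i, j) (i', j')) :
    (W ≤ j ∧ i' = i ∧ (j = W ∧ j' + 1 = W ∨ j + 1 = C ∧ j ≠ W ∧ j' = 0)) ∨
    (j < W ∧ j' = j ∧ (i = i' + 1 ∧ i + 1 < R ∨ i + 1 = R ∧ i' = 0)) := by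
  rw [natTorus_adj] at hadj
  rcases hadj with ⟨hb, ⟨rfl, h | h | h | h⟩ | ⟨rfl, h | h | h | h⟩⟩ <;> omega

theorem rows_gap {R C W r c : ℕ} (hc : c < W) (hr : 1 ≤ r)
    (hR : r + 3 ≤ R ∨ (c = 0 ∧ r + 2 ≤ R)) (hW : W = C ∨ W + 2 ≤ C) {x y y' : ℕ × ℕ}
    (hx : x ∉ box R C fun i j => j < W ∧ i < rowHeight r c j)
    (hy : y ∈ box R C fun i j => j < W ∧ i < rowHeight r c j)
    (hy' : y' ∈ box R C fun i j => j < W ∧ i < rowHeight r c j)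
    (hadj : (natTorus R C).Adj x y) (hadj' : (natTorus R C).Adj x y') :
    y = y' ∨ notchCorner W r c y.1 y.2 ∧ notchCorner W r c y'.1 y'.2 := by
  obtain ⟨i, j⟩ := x
  obtain ⟨i₁, j₁⟩ := y
  obtain ⟨i₂, j₂⟩ := y'
  have hij := (natTorus_adj.1 hadj).1
  rw [mem_box, lt_rowHeight_iff] at hx hy hy'
  have hx' : ¬ (j < W ∧ (i < r ∨ (i = r ∧ j < c))) := fun h => hx ⟨⟨hij.1, hij.2.1⟩, h⟩
  by_cases h : i = r ∧ 1 ≤ c ∧ j < W ∧ (j = c ∨ j + 1 = C)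
  · right
    exact ⟨notchCorner_of_adj hc hr (by omega) h (by omega) (fun e => hx' ⟨h.2.2.1, e⟩) hy.2 hadj,
      notchCorner_of_adj hc hr (by omega) h (by omega) (fun e => hx' ⟨h.2.2.1, e⟩) hy'.2 hadj'⟩
  · left
    have h1 := rows_adj_cases hc hr hR hW h hx' hy.2 hadj
    have h2 := rows_adj_cases hc hr hR hW h hx' hy'.2 hadj'
    clear hadj hadj' hx hx' h hij hR hr
    rw [Prod.mk.injEq]
    rcases h1 with ⟨h1, rfl, h3⟩ | ⟨h1, rfl, h3⟩ <;>
      rcases h2 with ⟨h2, rfl, h4⟩ | ⟨h2, rfl, h4⟩ <;> omega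

/-- The first column of odd height, for the heights `rowHeight r c` in the columns `j < W`. -/
def rowsFirst (r c : ℕ) : ℕ := if r % 2 = 0 then 0 else c

/-- The first column after those of odd height, for the heights `rowHeight r c`. -/
def rowsLast (W r c : ℕ) : ℕ := if r % 2 = 0 then c else W

theorem rowHeight_odd_iff {W r c j : ℕ} (hj : j < W) :
    rowsFirst r c ≤ j ∧ j < rowsLast W r c ↔ rowHeight r c j % 2 = 1 := by
  unfold rowsFirst rowsLast rowHeight
  split_ifs <;> omega

/-- The dominoes contain one, with selected node `q₀` in row `0`, to which `IsPairing.erase`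
applies. The condition `q₂.1 ≠ 0` ensures `q₂ ≠ q₀`. -/
theorem exists_breakable_rows {R C W r c : ℕ} (hW : W ≤ C) (hW4 : 4 ≤ W) (hc : c < W)
    (hr : 3 ≤ r) (hR : r + 1 < R) :
    ∃ q₀ ∈ box R C fun i j => (j < W ∧ i < rowHeight r c j) ∧
        columnsRight (rowHeight r c) (rowsFirst r c) i j,
      ∃ q₁ ∈ box R C fun i j => (j < W ∧ i < rowHeight r c j) ∧
        columnsRight (rowHeight r c) (rowsFirst r c) i j,
      ∃ q₂ ∈ box R C fun i j => (j < W ∧ i < rowHeight r c j) ∧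
        columnsRight (rowHeight r c) (rowsFirst r c) i j,
      q₀.1 = 0 ∧ q₂.1 ≠ 0 ∧ (natTorus R C).Adj q₀ q₁ ∧
        (natTorus R C).Adj (columnsPartner (rowHeight r c) (rowsFirst r c) q₀) q₂ := by
  have hlast : rowsLast W r c ≤ W := by
    unfold rowsLast
    split_ifs <;> omega
  have hH : ∀ j, r ≤ rowHeight r c j := by
    intro j
    unfold rowHeight
    split_ifs <;> omega
  rcases Nat.lt_or_ge (rowsFirst r c + 1) (rowsLast W r c) with h | h
  · -- Two odd columns: break the horizontal domino at their top.
    have h1 := (rowHeight_odd_iff (W := W) (r := r) (c := c) (j := rowsFirst r c)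
      (by omega)).1 (by omega)
    have h2 := (rowHeight_odd_iff (W := W) (r := r) (c := c) (j := rowsFirst r c + 1)
      (by omega)).1 (by omega)
    have h3 := hH (rowsFirst r c)
    have h4 := hH (rowsFirst r c + 1)
    refine ⟨(0, rowsFirst r c + 1), ?_, (1, rowsFirst r c + 1), ?_, (1, rowsFirst r c), ?_, rfl,
      one_ne_zero, ?_, ?_⟩
    · rw [mem_box]
      exact ⟨by omega, by omega, Or.inr ⟨rfl, h2, by omega⟩⟩
    · rw [mem_box]
      exact ⟨by omega, by omega, Or.inl h2.symm⟩
    · rw [mem_box]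
      exact ⟨by omega, by omega, Or.inl h1.symm⟩
    · rw [natTorus_adj]
      exact ⟨by omega, Or.inl ⟨rfl, Or.inl rfl⟩⟩
    · rw [columnsPartner_top_right h2 (by omega), natTorus_adj, Nat.add_sub_cancel]
      exact ⟨by omega, Or.inl ⟨rfl, Or.inl rfl⟩⟩
  · -- Otherwise two adjacent columns have the same even height, which is at least four.
    obtain ⟨j, j', hj, hj', hjj, h1, h2, h3⟩ : ∃ j j', j < W ∧ j' < W ∧ (j + 1 = j' ∨ j' + 1 = j) ∧
        rowHeight r c j % 2 = 0 ∧ rowHeight r c j' % 2 = 0 ∧ 4 ≤ rowHeight r c j := by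
      unfold rowsFirst rowsLast at h
      rcases Nat.mod_two_eq_zero_or_one r with hr2 | hr2
      · rw [if_pos hr2, if_pos hr2] at h
        refine ⟨W - 1, W - 2, by omega, by omega, by omega, ?_⟩
        unfold rowHeight
        split_ifs <;> omega
      · rw [if_neg (by omega), if_neg (by omega)] at h
        refine ⟨0, 1, by omega, by omega, by omega, ?_⟩
        unfold rowHeight
        split_ifs <;> omega
    have h4 := hH j'
    refine ⟨(0, j), ?_, (0, j'), ?_, (2, j), ?_, rfl, two_ne_zero, ?_, ?_⟩
    · rw [mem_box]
      exact ⟨by omega, by omega, Or.inl h1.symm⟩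
    · rw [mem_box]
      exact ⟨by omega, by omega, Or.inl h2.symm⟩
    · rw [mem_box]
      exact ⟨by omega, by omega, Or.inl h1.symm⟩
    · rw [natTorus_adj]
      exact ⟨by omega, Or.inr ⟨rfl, by omega⟩⟩
    · rw [columnsPartner_of_eq h1.symm, natTorus_adj]
      exact ⟨by omega, Or.inl ⟨rfl, Or.inl rfl⟩⟩

theorem IsPairing.card_extra_erase {V : Type*} [DecidableEq V] {G : SimpleGraph V}
    {L Q X : Finset V} {π : V → V} (h : IsPairing G L Q X π) {q : V} (hq : q ∈ Q) :
    (insert q (insert (π q) X)).card = X.card + 2 := by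
  have h1 : q ∉ L := fun e => Finset.disjoint_left.1 h.disjoint e hq
  rw [Finset.card_insert_of_notMem, Finset.card_insert_of_notMem (h.notMem_extra q hq)]
  rw [Finset.mem_insert, not_or]
  exact ⟨fun e => h1 (e ▸ h.mem_left q hq), fun e => h1 (h.subset e)⟩

/-- The region of `rowHeight r c` has a division into dominoes with `m` or `m + 1` extra nodes,
for `m = 0` and, after breaking a domino, for `m = 2`. -/
theorem exists_pairing_rows {R C W r c : ℕ} (hW : W ≤ C) (hW4 : 4 ≤ W) (hc : c < W)
    (hr : 3 ≤ r) (hR : r + 3 ≤ R ∨ (c = 0 ∧ r + 2 ≤ R)) (m : ℕ) (hm : m = 0 ∨ m = 2) :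
    ∃ (L Q X : Finset (ℕ × ℕ)) (π : ℕ × ℕ → ℕ × ℕ), IsPairing (natTorus R C) L Q X π ∧
      L ∪ Q = (box R C fun i j => j < W ∧ i < rowHeight r c j) ∧
      (∀ i j, i < R → j < C → (j < W ∧ i < rowHeight r c j) → notchCorner W r c i j → (i, j) ∈ L) ∧
      m ≤ X.card ∧ X.card ≤ m + 1 := by
  have hodd : ∀ j < W, rowsFirst r c ≤ j ∧ j < rowsLast W r c ↔ rowHeight r c j % 2 = 1 :=
    fun j hj => rowHeight_odd_iff hj
  have ho' : rowsLast W r c ≤ W := by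
    unfold rowsLast
    split_ifs <;> omega
  have hH : ∀ j < W, 2 ≤ rowHeight r c j := by
    intro j hj
    unfold rowHeight
    split_ifs <;> omega
  have hHR : ∀ j < W, rowHeight r c j < R := by
    intro j hj
    unfold rowHeight
    split_ifs <;> omega
  have hp := isPairing_columns hW hodd ho' hH hHR
  have hcorner : ∀ i j, i < R → j < C → (j < W ∧ i < rowHeight r c j) → notchCorner W r c i j →
      (i, j) ∈ box R C fun i j => (j < W ∧ i < rowHeight r c j) ∧
        ¬ columnsRight (rowHeight r c) (rowsFirst r c) i j := by
    intro i j hi hj hS h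
    rw [mem_box]
    refine ⟨⟨hi, hj⟩, hS, ?_⟩
    have : i + 1 = rowHeight r c j := by
      unfold notchCorner at h
      unfold rowHeight at hS ⊢
      split_ifs at hS ⊢ <;> omega
    rintro (h1 | ⟨h1, -⟩)
    · omega
    · have := hH j hS.1
      omega
  have hX : (box R C fun i j => i = 0 ∧ rowsFirst r c ≤ j ∧ j + 1 = rowsLast W r c ∧
      (rowsLast W r c - rowsFirst r c) % 2 = 1).card ≤ 1 := by
    refine card_box_le_length [(0, rowsLast W r c - 1)] ?_
    intro i j _ _ h
    rw [List.mem_singleton, Prod.mk.injEq]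
    omega
  rcases hm with rfl | rfl
  · exact ⟨_, _, _, _, hp, box_union_not _ _ _ _, hcorner, Nat.zero_le _, hX⟩
  · obtain ⟨q₀, h₀, q₁, h₁, q₂, h₂, h00, h20, h01, h02⟩ :=
      exists_breakable_rows hW hW4 hc hr (show r + 1 < R by omega)
    refine ⟨_, _, _, _, hp.erase h₀ h₁ h₂ h01 (fun e => h20 (e ▸ h00)) h02 ?_, ?_, ?_, ?_⟩
    · rintro ⟨i, j⟩ h
      rw [mem_box] at h
      obtain ⟨hb, rfl, h1, h2, h3⟩ := h
      have h4 := (hodd j (by omega)).1 ⟨h1, by omega⟩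
      have h5 := hH j (by omega)
      refine ⟨(1, j), ?_, fun e => ?_, ?_⟩
      · rw [mem_box]
        exact ⟨by omega, by omega, Or.inl h4.symm⟩
      · rw [← e] at h00
        exact one_ne_zero h00
      · rw [natTorus_adj]
        exact ⟨by omega, Or.inl ⟨rfl, Or.inl rfl⟩⟩
    · rw [Finset.insert_union, ← Finset.union_insert, Finset.insert_erase h₀, box_union_not]
    · exact fun i j hi hj hS h => Finset.mem_insert_of_mem (hcorner i j hi hj hS h)
    · rw [hp.card_extra_erase h₀]
      omega

/-- Equilibria when the agents fit into consecutive rows of width `W`. Type `A` may have up to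
three agents more than all others together; in that case the pairing with at least two extra nodes
is used, so that `#L` is at least `typeSize t A`. -/
theorem exists_equilibrium_rows {N T : Type*} [Fintype N] [DecidableEq N] [Countable T]
    {R C W r c : ℕ} (hW : W = C ∨ W + 2 ≤ C) (hW4 : 4 ≤ W) (hc : c < W)
    (hr : 3 ≤ r) (hR : r + 3 ≤ R ∨ (c = 0 ∧ r + 2 ≤ R)) (hN : Fintype.card N = r * W + c)
    (t : N → T) (A : T) (hmax : ∀ d, typeSize t d ≤ typeSize t A) (h8 : 8 ≤ typeSize t A)
    (hthird : ∀ d ≠ A, typeSize t d + typeSize t A + 1 ≤ Fintype.card N)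
    (hA : 2 * typeSize t A ≤ Fintype.card N + 3) :
    ∃ v : N → ℕ × ℕ, IsEquilibrium (natTorus R C) t v ∧ ∀ i, (v i).1 < R ∧ (v i).2 < C := by
  have hWC : W ≤ C := by omega
  -- `#L - #Q = #X` has the parity of the number of agents, so `#X ≥ 2` gives `typeSize t A ≤ #L`.
  obtain ⟨L, Q, X, π, hp, hLQ, hcorner, hm, hX⟩ := exists_pairing_rows hWC hW4 hc hr hR
    (if 2 * typeSize t A ≤ Fintype.card N then 0 else 2) (by split_ifs <;> simp)
  have hHR : ∀ j < W, rowHeight r c j < R := by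
    intro j _
    unfold rowHeight
    split_ifs <;> omega
  have hcard := card_rows_region hWC hc hHR
  rw [← hLQ, ← hN, Finset.card_union_of_disjoint hp.disjoint] at hcard
  have hL := hp.card_left
  have hZ : (box R C fun i j => notchCorner W r c i j ∧ j < W ∧ i < rowHeight r c j).card ≤ 4 :=
    card_box_le_length [(r, 0), (r, c - 1), (r - 1, c), (r - 1, W - 1)]
      fun i j _ _ h => mem_of_notchCorner h.1
  have hY := Finset.card_union_le X
    (box R C fun i j => notchCorner W r c i j ∧ j < W ∧ i < rowHeight r c j)
  refine (exists_equilibrium_of_pairing t A hp hcard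
    (Y := X ∪ box R C fun i j => notchCorner W r c i j ∧ j < W ∧ i < rowHeight r c j)
    Finset.subset_union_left ?_ ?_ ?_ ?_ ?_).imp
    fun v hv => ⟨hv.1, fun i => box_lt (hLQ ▸ hv.2 i)⟩
  · refine Finset.union_subset hp.subset ?_
    rintro ⟨i, j⟩ h
    rw [mem_box] at h
    exact hcorner i j h.1.1 h.1.2 h.2.2 h.2.1
  · split_ifs at hX <;> omega
  · split_ifs at hm <;> omega
  · intro d hd
    have h1 := hthird d hd
    have h2 := hmax d
    split_ifs at hm hX <;> omega
  · rw [hLQ]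
    intro x hx y hy y' hy' hadj hadj'
    rcases rows_gap hc (by omega) hR hW hx hy hy' hadj hadj' with h | ⟨h, h'⟩
    · exact Or.inl h
    · right
      obtain ⟨i, j⟩ := y
      obtain ⟨i', j'⟩ := y'
      rw [mem_box] at hy hy'
      exact ⟨Finset.mem_union_right _ (mem_box.2 ⟨hy.1, h, hy.2⟩),
        Finset.mem_union_right _ (mem_box.2 ⟨hy'.1, h', hy'.2⟩)⟩

/-! ### Shielded bands of rows -/

/-- The `k`-th node in the order that runs through the pairs of rows `3 u + 1`, `3 u + 2` one
after the other, column by column, taking the upper node of a column first. -/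
def bandCell (C k : ℕ) : ℕ × ℕ := (3 * (k / 2 / C) + 1 + k % 2, k / 2 % C)

/-- The place of a node `(i, j)` in the order of `bandCell`; meaningful only if `3` does not
divide `i`. -/
def bandIndex (C i j : ℕ) : ℕ := 2 * (i / 3 * C + j) + (i % 3 - 1)

/-- The node `(i, j)` is one of the first `s` nodes in the order of `bandCell`. -/
def inBand (C s i j : ℕ) : Prop := i % 3 ≠ 0 ∧ bandIndex C i j < s

/-- The neighbor of a band node in the adjacent row outside its pair of rows. -/
def outward (R : ℕ) (x : ℕ × ℕ) : ℕ × ℕ :=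
  if x.1 % 3 = 1 then (x.1 - 1, x.2) else if x.1 + 1 = R then (0, x.2) else (x.1 + 1, x.2)

theorem bandIndex_eq {C u j p : ℕ} (hp : p ≤ 1) :
    bandIndex C (3 * u + 1 + p) j = 2 * (u * C + j) + p := by
  unfold bandIndex
  rw [show (3 * u + 1 + p) / 3 = u by omega]
  omega

theorem bandCell_eq {C u j p : ℕ} (hp : p ≤ 1) (hj : j < C) :
    bandCell C (2 * (u * C + j) + p) = (3 * u + 1 + p, j) := by
  unfold bandCell
  rw [show (2 * (u * C + j) + p) / 2 = j + C * u by rw [mul_comm C]; omega,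
    show (2 * (u * C + j) + p) % 2 = p by omega, Nat.add_mul_div_left _ _ (by omega),
    Nat.add_mul_mod_self_left, Nat.div_eq_of_lt hj, Nat.mod_eq_of_lt hj, zero_add]

/-- Coordinates of a band node. As the band fills less than half of the torus, it ends before the
rows do: the row below its pair of rows is either a row of the torus or wraps around to row
`0`. -/
theorem exists_of_inBand {R C s i j : ℕ} (hR : 9 ≤ R) (hs : 2 * s < R * C) (h : inBand C s i j) :
    ∃ u p, p ≤ 1 ∧ i = 3 * u + 1 + p ∧ 2 * (u * C + j) + p < s ∧ 3 * u + 3 ≤ R := by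
  obtain ⟨h1, h2⟩ := h
  obtain ⟨u, p, hp, rfl⟩ : ∃ u p, p ≤ 1 ∧ i = 3 * u + 1 + p :=
    ⟨i / 3, i % 3 - 1, by omega, by omega⟩
  rw [bandIndex_eq hp] at h2
  refine ⟨u, p, hp, rfl, h2, ?_⟩
  have h3 : 4 * u < R := by
    by_contra hcon
    have := Nat.mul_le_mul_right C (not_lt.1 hcon)
    rw [mul_assoc] at this
    omega
  omega

theorem inBand_iff {C s u j p : ℕ} (hp : p ≤ 1) :
    inBand C s (3 * u + 1 + p) j ↔ 2 * (u * C + j) + p < s := by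
  unfold inBand
  rw [bandIndex_eq hp]
  exact and_iff_right (by omega)

theorem card_inBand {R C s : ℕ} (hR : 9 ≤ R) (hC : 0 < C) (hs : 2 * s < R * C) :
    (box R C (inBand C s)).card = s := by
  suffices key : (Finset.range s).card = (box R C (inBand C s)).card by
    rw [← key, Finset.card_range]
  refine Finset.card_nbij' (bandCell C) (fun x => bandIndex C x.1 x.2) ?_ ?_ ?_ ?_
  · intro k hk
    rw [Finset.mem_coe, Finset.mem_range] at hk
    rw [Finset.mem_coe, bandCell, mem_box]
    have h1 : inBand C s (3 * (k / 2 / C) + 1 + k % 2) (k / 2 % C) := by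
      rw [inBand_iff (by omega)]
      have := Nat.div_add_mod (k / 2) C
      rw [mul_comm] at this
      rw [this]
      omega
    obtain ⟨u, p, hp, h2, -, h3⟩ := exists_of_inBand hR hs h1
    exact ⟨⟨by omega, Nat.mod_lt _ hC⟩, h1⟩
  · rintro ⟨i, j⟩ h
    rw [Finset.mem_coe, mem_box] at h
    exact Finset.mem_coe.2 (Finset.mem_range.2 h.2.2)
  · intro k _
    dsimp only [bandCell]
    rw [bandIndex_eq (by omega)]
    have := Nat.div_add_mod (k / 2) C
    rw [mul_comm] at this
    rw [this]
    omega
  · rintro ⟨i, j⟩ h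
    rw [Finset.mem_coe, mem_box] at h
    obtain ⟨u, p, hp, rfl, -⟩ := exists_of_inBand hR hs h.2
    dsimp only
    rw [bandIndex_eq hp, bandCell_eq hp h.1.2]

theorem outward_spec {R C s i j : ℕ} (hR : 9 ≤ R) (hs : 2 * s < R * C) (hj : j < C)
    (h : inBand C s i j) :
    (natTorus R C).Adj (i, j) (outward R (i, j)) ∧
      outward R (i, j) ∉ box R C (inBand C s) := by
  obtain ⟨u, p, hp, rfl, h1, h2⟩ := exists_of_inBand hR hs h
  unfold outward
  dsimp only
  split_ifs with h3 h4
  · rw [natTorus_adj, mem_box]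
    unfold inBand
    exact ⟨⟨by omega, Or.inl ⟨rfl, by omega⟩⟩, by omega⟩
  · rw [natTorus_adj, mem_box]
    unfold inBand
    exact ⟨⟨by omega, Or.inl ⟨rfl, by omega⟩⟩, by omega⟩
  · rw [natTorus_adj, mem_box]
    unfold inBand
    exact ⟨⟨by omega, Or.inl ⟨rfl, by omega⟩⟩, by omega⟩

/-- The boundary of the band consists of the outward neighbors and at most four other nodes: the
next two nodes after the band, and the nodes in the last column adjacent to its last, incomplete
pair of rows by wraparound. -/
theorem eq_outward_or_mem_of_adj {R C s i j i' j' : ℕ} (hR : 9 ≤ R)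
    (hs : 2 * s < R * C) (h : inBand C s i j) (h' : ¬ inBand C s i' j')
    (hadj : (natTorus R C).Adj (i, j) (i', j')) :
    (i', j') = outward R (i, j) ∨ (i', j') ∈ [bandCell C s, bandCell C (s + 1),
      (3 * ((s - 1) / (2 * C)) + 1, C - 1), (3 * ((s - 1) / (2 * C)) + 2, C - 1)] := by
  obtain ⟨u, p, hp, rfl, h1, h2⟩ := exists_of_inBand hR hs h
  rw [natTorus_adj] at hadj
  simp only [List.mem_cons, List.not_mem_nil, or_false]
  have hcell : ∀ k, i' = 3 * u + 1 + k → k ≤ 1 → s ≤ 2 * (u * C + j') + k := by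
    rintro k rfl hk
    rw [inBand_iff hk] at h'
    omega
  obtain ⟨⟨hb1, hb2, hb3, hb4⟩, ⟨rfl, hv⟩ | ⟨rfl, hh⟩⟩ := hadj
  · rcases Nat.le_one_iff_eq_zero_or_eq_one.1 hp with rfl | rfl
    · -- The upper row of a band: the cell above lies outside, the cell below is the next one.
      rcases (show i' = 3 * u ∨ i' = 3 * u + 1 + 1 by omega) with rfl | rfl
      · left
        unfold outward
        dsimp only
        rw [if_pos (by omega)]
        rfl
      · right; left
        have h3 := hcell 1 rfl le_rfl
        rw [show s = 2 * (u * C + j) + 1 by omega, bandCell_eq le_rfl hb2]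
    · rcases (show i' = 3 * u + 1 + 0 ∨ i' = 3 * u + 3 ∨ (i' = 0 ∧ 3 * u + 3 = R) by omega)
        with rfl | rfl | ⟨rfl, h3⟩
      · have h3 := hcell 0 rfl (by omega)
        omega
      · left
        unfold outward
        dsimp only
        rw [if_neg (by omega), if_neg (by omega)]
      · left
        unfold outward
        dsimp only
        rw [if_neg (by omega), if_pos (by omega)]
  · right
    have h3 := hcell p rfl hp
    rcases (show j' = j + 1 ∨ j' ≤ j ∨ (j = 0 ∧ j' + 1 = C) by omega) with rfl | h4 | ⟨rfl, h4⟩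
    · rcases (show s = 2 * (u * C + (j + 1)) + p ∨ s + 1 = 2 * (u * C + (j + 1)) + p by omega)
        with h5 | h5
      · left
        rw [h5, bandCell_eq hp hb4]
      · right; left
        rw [h5, bandCell_eq hp hb4]
    · omega
    · right; right
      have h5 : (s - 1) / (2 * C) = u := by
        rw [Nat.div_eq_iff (by omega)]
        have h6 : u * (2 * C) = 2 * (u * C) := by ring
        omega
      rw [h5, show C - 1 = j' by omega]
      rcases Nat.le_one_iff_eq_zero_or_eq_one.1 hp with rfl | rfl
      · left; rfl
      · right; rfl

/-- If the band reaches the third column of its second pair of rows, the nodes `(2, j)` and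
`(4, j)` have the same outward neighbor for `j < 3`, so three boundary nodes are saved. -/
theorem card_image_outward_le {R C s : ℕ} (hR : 9 ≤ R) (hC : 9 ≤ C) (hs : 2 * s < R * C)
    (h : 2 * C + 5 ≤ s) : ((box R C (inBand C s)).image (outward R)).card + 3 ≤ s := by
  have hband : ∀ j < 3, inBand C s 4 j ∧ inBand C s 2 j := by
    intro j hj
    exact ⟨(inBand_iff (u := 1) (p := 0) zero_le_one).2 (by omega),
      (inBand_iff (u := 0) (p := 1) le_rfl).2 (by omega)⟩
  have h1 : ({4} ×ˢ Finset.range 3 : Finset (ℕ × ℕ)) ⊆ box R C (inBand C s) := by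
    rintro ⟨i, j⟩ hx
    simp only [Finset.mem_product, Finset.mem_singleton, Finset.mem_range] at hx
    obtain ⟨rfl, hj⟩ := hx
    exact mem_box.2 ⟨by omega, (hband j hj).1⟩
  have h2 : (box R C (inBand C s)).image (outward R) ⊆
      (box R C (inBand C s) \ ({4} ×ˢ Finset.range 3)).image (outward R) := by
    intro y hy
    obtain ⟨⟨i, j⟩, hx, rfl⟩ := Finset.mem_image.1 hy
    by_cases hx' : (i, j) ∈ ({4} ×ˢ Finset.range 3 : Finset (ℕ × ℕ))
    · simp only [Finset.mem_product, Finset.mem_singleton, Finset.mem_range] at hx'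
      obtain ⟨rfl, hj⟩ := hx'
      refine Finset.mem_image.2 ⟨(2, j), ?_, ?_⟩
      · rw [Finset.mem_sdiff, mem_box]
        exact ⟨⟨by omega, (hband j hj).2⟩, by simp⟩
      · unfold outward
        dsimp only
        rw [if_neg (by omega), if_neg (by omega), if_pos (by omega)]
    · exact Finset.mem_image_of_mem _ (Finset.mem_sdiff.2 ⟨hx, hx'⟩)
  have h3 := (Finset.card_le_card h2).trans Finset.card_image_le
  rw [Finset.card_sdiff_of_subset h1, card_inBand hR (by omega) hs] at h3
  have h4 : ({4} ×ˢ Finset.range 3 : Finset (ℕ × ℕ)).card = 3 := rfl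
  omega

/-- Equilibria when type `A` has more agents than all others together, by enclosing the others in
a band shielded by type `A`. -/
theorem exists_equilibrium_band {N T : Type*} [Fintype N] [DecidableEq N] [Countable T]
    {R C s : ℕ} (hR : 9 ≤ R) (hC : 9 ≤ C) (hN : Fintype.card N < R * C) (t : N → T) (A : T)
    (hs : s + typeSize t A = Fintype.card N) (hA : s < typeSize t A)
    (h : s + 4 ≤ typeSize t A ∨ 2 * C + 5 ≤ s) :
    ∃ v : N → ℕ × ℕ, IsEquilibrium (natTorus R C) t v ∧ ∀ i, (v i).1 < R ∧ (v i).2 < C := by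
  have hs2 : 2 * s < R * C := by omega
  have hQ := card_inBand hR (show 0 < C by omega) hs2
  set Q := box R C (inBand C s) with hQdef
  let l : List (ℕ × ℕ) := [bandCell C s, bandCell C (s + 1),
      (3 * ((s - 1) / (2 * C)) + 1, C - 1), (3 * ((s - 1) / (2 * C)) + 2, C - 1)]
  have hB : ∀ B ⊆ Q.image (outward R) ∪ l.toFinset, B.card ≤ typeSize t A := by
    intro B hB
    have h1 := (Finset.card_le_card hB).trans (Finset.card_union_le _ _)
    have h2 : l.toFinset.card ≤ 4 := l.toFinset_card_le
    rcases h with h | h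
    · have h3 : (Q.image (outward R)).card ≤ Q.card := Finset.card_image_le
      omega
    · have h3 := card_image_outward_le hR hC hs2 h
      rw [← hQdef] at h3
      omega
  have hQbox : Q ⊆ box R C fun _ _ => True := by
    rintro ⟨i, j⟩ hx
    rw [hQdef, mem_box] at hx
    exact mem_box.2 ⟨hx.1, trivial⟩
  let B := ((Q.image (outward R) ∪ l.toFinset) ∩ box R C fun _ _ => True)
  obtain ⟨S, hS1, hS2, hS⟩ := Finset.exists_subsuperset_card_eq (s := Q ∪ B)
    (t := box R C fun _ _ => True) (n := Fintype.card N)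
    (Finset.union_subset hQbox Finset.inter_subset_right)
    ((Finset.card_union_le _ _).trans (by
      have := hB B Finset.inter_subset_left
      omega))
    (by rw [card_box_true]; omega)
  have hbd : ∀ q ∈ Q, ∀ x, (natTorus R C).Adj q x → x ∈ S := by
    rintro ⟨i, j⟩ hq ⟨i', j'⟩ hadj
    by_cases hx : (i', j') ∈ Q
    · exact hS1 (Finset.mem_union_left _ hx)
    have hb := (natTorus_adj.1 hadj).1
    refine hS1 (Finset.mem_union_right _ (Finset.mem_inter.2
      ⟨?_, mem_box.2 ⟨⟨hb.2.2.1, hb.2.2.2⟩, trivial⟩⟩))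
    rcases eq_outward_or_mem_of_adj hR hs2 (mem_box.1 hq).2
      (fun e => hx (mem_box.2 ⟨hb.2.2, e⟩)) hadj with h1 | h1
    · rw [h1]
      exact Finset.mem_union_left _ (Finset.mem_image_of_mem _ hq)
    · exact Finset.mem_union_right _ (List.mem_toFinset.2 h1)
  refine (exists_equilibrium_of_shield (G := natTorus R C) t A
    (Finset.subset_union_left.trans hS1) hS (by omega) ?_ hbd).imp
    fun v hv => ⟨hv.1, fun i => box_lt (hS2 (hv.2 i))⟩
  rintro ⟨i, j⟩ hq
  have h1 := outward_spec hR hs2 (mem_box.1 hq).1.2 (mem_box.1 hq).2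
  exact ⟨_, hbd _ hq _ h1.1, h1.2, h1.1⟩

/-! ### Existence of an equilibrium -/

theorem typeSize_le_card {N T : Type*} [Fintype N] (t : N → T) (c : T) :
    typeSize t c ≤ Fintype.card N := by
  classical
  rw [typeSize_eq_card]
  exact Finset.card_le_univ _

/-- Two types never comprise all agents, since there is a third non-empty type. -/
theorem typeSize_add_typeSize_lt_card {N : Type*} [Fintype N] {k : ℕ} (hk : 3 ≤ k)
    {t : N → Fin k} (ht : Function.Surjective t) {c d : Fin k} (hcd : d ≠ c) :
    typeSize t d + typeSize t c + 1 ≤ Fintype.card N := by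
  classical
  obtain ⟨e, he⟩ : ∃ e, e ∉ ({c, d} : Finset (Fin k)) := by
    by_contra! h
    have h1 : (Finset.univ : Finset (Fin k)).card ≤ ({c, d} : Finset (Fin k)).card :=
      Finset.card_le_card fun x _ => h x
    have h2 := Finset.card_le_two (a := c) (b := d)
    rw [Finset.card_univ, Fintype.card_fin] at h1
    omega
  obtain ⟨i, rfl⟩ := ht e
  rw [Finset.mem_insert, Finset.mem_singleton, not_or] at he
  rw [typeSize_eq_card, typeSize_eq_card, ← Finset.card_union_of_disjoint]
  · refine Finset.card_lt_univ_of_notMem (x := i) ?_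
    simp [he.1, he.2]
  · rw [Finset.disjoint_filter]
    rintro j - rfl h
    exact hcd h

/-- Equilibria with at least two rows of empty nodes: use rows of full width if there are at least
three of them, and rows of width `4` otherwise. -/
theorem exists_equilibrium_sparse {N T : Type*} [Fintype N] [DecidableEq N] [Countable T]
    {R C : ℕ} (hRC : C ≤ R) (hC : 9 ≤ C) (hN : Fintype.card N + 2 * C ≤ R * C)
    (t : N → T) (A : T) (hmax : ∀ d, typeSize t d ≤ typeSize t A) (h8 : 8 ≤ typeSize t A)
    (hthird : ∀ d ≠ A, typeSize t d + typeSize t A + 1 ≤ Fintype.card N)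
    (hA : 2 * typeSize t A ≤ Fintype.card N + 3) :
    ∃ v : N → ℕ × ℕ, IsEquilibrium (natTorus R C) t v ∧ ∀ i, (v i).1 < R ∧ (v i).2 < C := by
  by_cases h3 : 3 * C ≤ Fintype.card N
  · have hdm := Nat.div_add_mod' (Fintype.card N) C
    have hc := Nat.mod_lt (Fintype.card N) (show 0 < C by omega)
    have hr : 3 ≤ Fintype.card N / C := (Nat.le_div_iff_mul_le (by omega)).2 h3
    refine exists_equilibrium_rows (W := C) (.inl rfl) (by omega) hc hr ?_ hdm.symm t A hmax h8
      hthird hA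
    have h2 : (Fintype.card N / C + 2) * C ≤ R * C := by rw [add_mul]; omega
    have h2' := Nat.le_of_mul_le_mul_right h2 (by omega)
    rcases Nat.eq_zero_or_pos (Fintype.card N % C) with h0 | h0
    · exact .inr ⟨h0, h2'⟩
    · have : Fintype.card N / C + 2 ≠ R := by
        rintro rfl
        rw [add_mul] at hN
        omega
      omega
  · exact exists_equilibrium_rows (W := 4) (r := Fintype.card N / 4) (c := Fintype.card N % 4)
      (.inr (by omega)) le_rfl (by omega) (by omega) (by omega) (by omega) t A hmax h8 hthird hA

end VarietyJump

theorem theorem8 (m₁ m₂ k : ℕ) (hm : m₂ ≤ m₁) (hm₂ : 9 ≤ m₂) (hk : 3 ≤ k)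
    {N : Type*} [Fintype N] [DecidableEq N] (hN : Fintype.card N < m₁ * m₂)
    (t : N → Fin k) (ht : Function.Surjective t)
    (hmax : ∃ c : Fin k, (∀ d : Fin k, VarietyJump.typeSize t d ≤ VarietyJump.typeSize t c) ∧
      8 ≤ VarietyJump.typeSize t c) :
    ∃ v : N → Fin m₁ × Fin m₂, VarietyJump.IsEquilibrium (VarietyJump.torus m₁ m₂) t v := by
  open VarietyJump in
  obtain ⟨A, hA, h8⟩ := hmax
  obtain ⟨s, hs⟩ := Nat.exists_eq_add_of_le' (typeSize_le_card t A)
  have h9 : 9 * m₂ ≤ m₁ * m₂ := Nat.mul_le_mul_right _ (by omega)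
  by_cases hbig : s + 4 ≤ typeSize t A
  · exact exists_equilibrium_torus
      (exists_equilibrium_band (by omega) hm₂ hN t A hs.symm (by omega) (.inl hbig))
  by_cases he : Fintype.card N + 2 * m₂ ≤ m₁ * m₂
  · exact exists_equilibrium_torus (exists_equilibrium_sparse hm hm₂ he t A hA h8
      (fun d hd => typeSize_add_typeSize_lt_card hk ht hd) (by omega))
  -- Now at least `7 * m₂ + 1` nodes are occupied, which makes `s` large.
  by_cases hlt : s < typeSize t A
  · exact exists_equilibrium_torus
      (exists_equilibrium_band (by omega) hm₂ hN t A hs.symm hlt (.inr (by omega)))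
  obtain ⟨e, he'⟩ := Nat.exists_eq_add_of_lt hN
  -- Rows and columns are exchanged only when this makes the number of rows even.
  by_cases hswap : m₁ % 2 = 1 ∧ m₂ % 2 = 0
  · refine exists_equilibrium_torus_swap (exists_equilibrium_gap hm₂ (by omega) (.inl hswap.2)
      (b := (e + 1) / 2) (δ := (e + 1) % 2) (by omega) (by omega) (by omega) ?_ t A hA h8
      (by omega))
    rw [mul_comm m₂ m₁]
    omega
  · exact exists_equilibrium_torus (exists_equilibrium_gap (by omega) hm₂ (by omega)
      (b := (e + 1) / 2) (δ := (e + 1) % 2) (by omega) (by omega) (by omega) (by omega) t A hA h8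
      (by omega))
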